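/- Let $\alpha_j>0$, $\beta_j>0$, $\sigma_j>1$ ($j\in\mathbb N=\{1,2,\dots\}$) be such that, as $j\to\infty$, $$\beta_j\sim c\,j^{-\tau},\qquad \alpha_j/\beta_j\to r,\qquad \sigma_j\to\infty,$$ where $c>0$, $\tau<1$ and $0\le r<\infty$. For every $d\in\mathbb N$ let $Y_d(t)$, $t\in[0,1]^d$, be a zero-mean measurable (real or complex) random field with finite second moments, on some probability space, with covariance function $$\mathcal K_d(t,s)=\sum_{j=1}^d\Bigl(\alpha_j+2\beta_j\sum_{k=1}^\infty k^{-\sigma_j}\cos\bigl(2\pi k(t_j-s_j)\bigr)\Bigr),\qquad t,s\in[0,1]^d,$$ that is, a sum of Korobov kernels. Regard $Y_d$ as a random element of $L_2([0,1]^d)$ (real or complex, respectively) with scalar product $(\cdot,\cdot)$ and norm $\|\cdot\|$. Put $$e_d(n)=\inf\Bigl\{\Bigl(\mathbb E\Bigl\|Y_d-\sum_{m=1}^n (Y_d,\psi_m)\,\psi_m\Bigr\|^2\Bigr)^{1/2}:\ \psi_1,\dots,\psi_n\in L_2([0,1]^d)\Bigr\},\qquad e_d(0)=\bigl(\mathbb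 E\|Y_d\|^2\bigr)^{1/2},$$ and let $$n_d(\varepsilon)=\min\{n\in\mathbb N:\ e_d(n)\le\varepsilon\,e_d(0)\}$$ be the average case approximation complexity of $Y_d$. Let $\varepsilon_0=(1+r/2)^{-1/2}$. Then for every $\varepsilon\in(0,\varepsilon_0)$ $$n_d(\varepsilon)\sim 2\,Q(\varepsilon)\,d,\qquad d\to\infty,$$ where $$Q(\varepsilon)=\begin{cases}\bigl(1-(\varepsilon/\varepsilon_0)^2\bigr)^{1/(1-\tau)},&\tau\in[0,1),\\[2pt] 1-(\varepsilon/\varepsilon_0)^{2/(1-\tau)},&\tau<0.\end{cases}$$ Here $a_n\sim b_n$ means $a_n/b_n\to1$. -/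

import Mathlib

open MeasureTheory Filter Topology
open scoped ENNReal ComplexConjugate

noncomputable section

/-- The cube `[0,1]^d`; its `volume` is Lebesgue measure on `[0,1]^d`. -/
abbrev Cube (d : ℕ) : Type := Fin d → unitInterval

/-- The Korobov kernel `α + 2 β ∑_{k ≥ 1} k^{-σ} cos (2 π k (t - s))`
(the series is absolutely convergent for `σ > 1`). -/
def korobovKernel (α β σ t s : ℝ) : ℝ :=
  α + 2 * β * ∑' k : ℕ, ((k + 1 : ℕ) : ℝ) ^ (-σ) *
    Real.cos (2 * Real.pi * ((k + 1 : ℕ) : ℝ) * (t - s))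

/-- The additive covariance function `∑_{j=1}^d K_{α_j, β_j, σ_j}(t_j, s_j)` on `[0,1]^d`.
The coordinates are numbered by `Fin d`, so the `j`-th one carries the parameters of
index `j + 1`. -/
def additiveKorobovCov (α β σ : ℕ → ℝ) (d : ℕ) (t s : Cube d) : ℝ :=
  ∑ j : Fin d, korobovKernel (α (j + 1)) (β (j + 1)) (σ (j + 1)) (t j) (s j)

/-- `Y` is a zero-mean, square integrable, (jointly) measurable random field on `[0,1]^d` with
covariance function `C`, real (`𝕜 = ℝ`) or complex (`𝕜 = ℂ`). When `C` is bounded, joint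
measurability makes almost every path an element of `L₂([0,1]^d)`. -/
structure IsCenteredField {𝕜 : Type*} [RCLike 𝕜] {Ω : Type*} [MeasurableSpace Ω]
    (P : Measure Ω) {d : ℕ} (Y : Cube d → Ω → 𝕜) (C : Cube d → Cube d → ℝ) : Prop where
  measurable : AEMeasurable (Function.uncurry Y) ((volume : Measure (Cube d)).prod P)
  memLp : ∀ t, MemLp (Y t) 2 P
  mean_zero : ∀ t, ∫ ω, Y t ω ∂P = 0
  cov : ∀ t s, ∫ ω, Y t ω * conj (Y s ω) ∂P = ((C t s : ℝ) : 𝕜)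

/-- The value at `t` of the rank `n` approximation `∑_{m=1}^n (Y, ψ_m) ψ_m` of the path
`Y(·, ω)`, with the scalar product `(f, g) = ∫ f * conj g` of `L₂([0,1]^d)`. -/
def rankApprox {𝕜 : Type*} [RCLike 𝕜] {Ω : Type*} {d n : ℕ} (Y : Cube d → Ω → 𝕜)
    (ψ : Fin n → Lp 𝕜 2 (volume : Measure (Cube d))) (t : Cube d) (ω : Ω) : 𝕜 :=
  ∑ m : Fin n, (∫ s, Y s ω * conj (ψ m s)) * ψ m t

/-- The smallest 2-average error
`e(n) = inf { (E ‖Y - ∑_{m=1}^n (Y, ψ_m) ψ_m‖²)^{1/2} : ψ_1, …, ψ_n ∈ L₂([0,1]^d) }`, as an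
extended nonnegative number. For `n = 0` this is `(E ‖Y‖²)^{1/2}`. -/
def averageError {𝕜 : Type*} [RCLike 𝕜] {Ω : Type*} [MeasurableSpace Ω]
    (P : Measure Ω) {d : ℕ} (Y : Cube d → Ω → 𝕜) (n : ℕ) : ℝ≥0∞ :=
  ⨅ ψ : Fin n → Lp 𝕜 2 (volume : Measure (Cube d)),
    (∫⁻ ω, ∫⁻ t, ‖Y t ω - rankApprox Y ψ t ω‖ₑ ^ 2 ∂volume ∂P) ^ (1 / 2 : ℝ)

/-- The average case approximation complexity
`n^Y(ε) = min { n ≥ 1 : e(n) ≤ ε e(0) }`. -/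
def approxComplexity {𝕜 : Type*} [RCLike 𝕜] {Ω : Type*} [MeasurableSpace Ω]
    (P : Measure Ω) {d : ℕ} (Y : Cube d → Ω → 𝕜) (ε : ℝ) : ℕ :=
  sInf {n : ℕ | 1 ≤ n ∧ averageError P Y n ≤ ENNReal.ofReal ε * averageError P Y 0}

/-- `ε₀ = (1 + r/2)^{-1/2}`. -/
def epsZero (r : ℝ) : ℝ := (1 + r / 2) ^ (-(1 / 2) : ℝ)

/-- `Q(ε) = (1 - (ε/ε₀)²)^{1/(1-τ)}` for `0 ≤ τ < 1` and `Q(ε) = 1 - (ε/ε₀)^{2/(1-τ)}`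
for `τ < 0`. -/
def korobovQ (τ r ε : ℝ) : ℝ :=
  if 0 ≤ τ then (1 - (ε / epsZero r) ^ 2) ^ (1 / (1 - τ))
  else 1 - (ε / epsZero r) ^ (2 / (1 - τ))

end

/-! For an orthonormal system the squared error is the trace `Λ` of the covariance minus the
captured variances `E |(Y, ψ_m)|²`. The covariance is a series of products of cosines and sines. All
constants `α_j` sit on one common direction, the constant function. Frequency one carries each `β_j`
twice, by a cosine and a sine. Higher frequencies are negligible because `σ_j → ∞` forces `∑
k^{-σ_j} → 1`. Hence the trace grows like `(r + 2) c d^{1-τ} / (1 - τ)`. Removing the constant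
direction leaves the share `2 / (r + 2) = ε₀²` of it asymptotically, and the rest of the reduction
must come from the `β_j`, two functions at a time.

Upper bound (`korobov_averageError_upper`): use the constant and the frequency-one pairs of the
coordinates with the largest asymptotic weights. For `τ ≥ 0` these are the first `x d` coordinates,
for `τ < 0` the last `(1 - x) d`. Power sums (`tendsto_sum_div_rpow`) turn the error condition into
`1 - x^{1-τ} = (ε/ε₀)²`, respectively `x^{1-τ} = (ε/ε₀)²`.

Lower bound (`korobov_averageError_lower`): sorting the eigenvalues is avoided by duality. For every
`θ ≥ 0` the squared error of rank `n` is at least `2 ∑ min(β_j, θ) - θ n`. Taking for `θ` the power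
weight at the cut `x d` makes this asymptotically sharp (`eventually_lt_div_of_dual`), and
truncation at `θ` is stable under replacing `β_j` by `c j^{-τ}`. -/

/-! ### Second moments of the field and of its scalar products -/

/-- Unfolding the square into a double integral lets the expectation pass inside, where only the
covariance of the field remains. -/
theorem integral_mul_conj_mul_eq {𝕜 : Type*} [RCLike 𝕜] {Ω : Type*} {d : ℕ} (Y : Cube d → Ω → 𝕜)
    (v : Lp 𝕜 2 (volume : Measure (Cube d))) (ω : Ω) :
    ∫ z : Cube d × Cube d, (Y z.1 ω * conj (Y z.2 ω)) * (conj (v z.1) * v z.2)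
      ∂((volume : Measure (Cube d)).prod volume) =
    ((‖∫ t, Y t ω * conj (v t)‖ ^ 2 : ℝ) : 𝕜) := by
  have h := integral_prod_mul (μ := (volume : Measure (Cube d))) (ν := (volume : Measure (Cube d)))
    (fun t => Y t ω * conj (v t)) (fun t => conj (Y t ω * conj (v t)))
  rw [integral_conj, RCLike.mul_conj] at h
  push_cast
  rw [← h]
  refine integral_congr_ae (.of_forall fun z => ?_)
  simp only [map_mul, RCLike.conj_conj]
  ring

namespace IsCenteredField

variable {𝕜 : Type*} [RCLike 𝕜] {Ω : Type*} [MeasurableSpace Ω] {P : Measure Ω} {d : ℕ}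
  {Y : Cube d → Ω → 𝕜} {C : Cube d → Cube d → ℝ} {Λ : ℝ}

theorem integral_norm_sq (hY : IsCenteredField P Y C) (t : Cube d) :
    ∫ ω, ‖Y t ω‖ ^ 2 ∂P = C t t := by
  have h := hY.cov t t
  simp only [RCLike.mul_conj] at h
  have h2 : ∫ ω, ((‖Y t ω‖ ^ 2 : ℝ) : 𝕜) ∂P = ((C t t : ℝ) : 𝕜) := by
    rw [← h]; simp
  rw [integral_ofReal] at h2
  exact_mod_cast h2

theorem integrable_norm_sq (hY : IsCenteredField P Y C) (t : Cube d) :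
    Integrable (fun ω => ‖Y t ω‖ ^ 2) P :=
  (memLp_two_iff_integrable_sq_norm (hY.memLp t).1).1 (hY.memLp t)

theorem integral_norm_mul_le (hY : IsCenteredField P Y C) (hC : ∀ t, C t t = Λ) (t s : Cube d) :
    ∫ ω, ‖Y t ω‖ * ‖Y s ω‖ ∂P ≤ Λ := by
  have h : ∫ ω, ‖Y t ω‖ * ‖Y s ω‖ ∂P ≤ ∫ ω, (‖Y t ω‖ ^ 2 + ‖Y s ω‖ ^ 2) / 2 ∂P := by
    refine integral_mono_of_nonneg (.of_forall fun ω => by positivity)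
      (((hY.integrable_norm_sq t).add (hY.integrable_norm_sq s)).div_const 2)
      (.of_forall fun ω => ?_)
    have := two_mul_le_add_sq ‖Y t ω‖ ‖Y s ω‖
    simp only
    linarith
  rw [integral_div, integral_add (hY.integrable_norm_sq t) (hY.integrable_norm_sq s),
    hY.integral_norm_sq, hY.integral_norm_sq, hC, hC] at h
  linarith

variable [IsProbabilityMeasure P]

theorem integrable_norm_sq_prod (hY : IsCenteredField P Y C) (hC : ∀ t, C t t = Λ) :
    Integrable (fun z : Cube d × Ω => ‖Y z.1 z.2‖ ^ 2) ((volume : Measure (Cube d)).prod P) := by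
  have hm : AEStronglyMeasurable (fun z : Cube d × Ω => ‖Y z.1 z.2‖ ^ 2)
      ((volume : Measure (Cube d)).prod P) := hY.measurable.aestronglyMeasurable.norm.pow 2
  rw [integrable_prod_iff hm]
  refine ⟨.of_forall hY.integrable_norm_sq, ?_⟩
  simp only [norm_pow, norm_norm, hY.integral_norm_sq, hC]
  exact integrable_const _

theorem memLp_path (hY : IsCenteredField P Y C) (hC : ∀ t, C t t = Λ) :
    ∀ᵐ ω ∂P, MemLp (fun t => Y t ω) 2 volume := by
  have hm := (hY.measurable.aestronglyMeasurable.prod_swap).prodMk_left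
  filter_upwards [hm, (hY.integrable_norm_sq_prod hC).prod_left_ae] with ω h1 h2
  exact (memLp_two_iff_integrable_sq_norm h1).2 h2

theorem integrable_integral_norm_sq (hY : IsCenteredField P Y C) (hC : ∀ t, C t t = Λ) :
    Integrable (fun ω => ∫ t, ‖Y t ω‖ ^ 2) P :=
  (hY.integrable_norm_sq_prod hC).integral_prod_right

theorem integral_integral_norm_sq (hY : IsCenteredField P Y C) (hC : ∀ t, C t t = Λ) :
    ∫ ω, (∫ t, ‖Y t ω‖ ^ 2) ∂P = Λ := by
  rw [← integral_integral_swap (f := fun t ω => ‖Y t ω‖ ^ 2) (hY.integrable_norm_sq_prod hC)]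
  simp [hY.integral_norm_sq, hC]

/-- Integrating over `ω` first costs at most the factor `Λ`, since the variance is constant. What
remains is integrable because `v`, being square integrable on a probability space, is integrable.
This justifies Fubini in `integral_norm_sq_integral`. -/
theorem integrable_mul_conj_mul (hY : IsCenteredField P Y C) (hC : ∀ t, C t t = Λ)
    (v : Lp 𝕜 2 (volume : Measure (Cube d))) :
    Integrable (fun z : (Cube d × Cube d) × Ω =>
        (Y z.1.1 z.2 * conj (Y z.1.2 z.2)) * (conj (v z.1.1) * v z.1.2))
      (((volume : Measure (Cube d)).prod volume).prod P) := by
  have hv : Integrable (v : Cube d → 𝕜) volume :=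
    (Lp.memLp v).integrable (by norm_num)
  have hv1 : Integrable (fun t => conj (v t)) volume :=
    (RCLike.conjCLE (K := 𝕜)).toContinuousLinearMap.integrable_comp hv
  have hvv : Integrable (fun z : Cube d × Cube d => conj (v z.1) * v z.2)
      ((volume : Measure (Cube d)).prod volume) := hv1.mul_prod hv
  have m1 : AEStronglyMeasurable (fun z : (Cube d × Cube d) × Ω => Y z.1.1 z.2)
      (((volume : Measure (Cube d)).prod volume).prod P) :=
    hY.measurable.aestronglyMeasurable.comp_measurePreserving
      (measurePreserving_fst.prod (MeasurePreserving.id P))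
  have m2 : AEStronglyMeasurable (fun z : (Cube d × Cube d) × Ω => Y z.1.2 z.2)
      (((volume : Measure (Cube d)).prod volume).prod P) :=
    hY.measurable.aestronglyMeasurable.comp_measurePreserving
      (measurePreserving_snd.prod (MeasurePreserving.id P))
  have hm : AEStronglyMeasurable (fun z : (Cube d × Cube d) × Ω =>
        (Y z.1.1 z.2 * conj (Y z.1.2 z.2)) * (conj (v z.1.1) * v z.1.2))
      (((volume : Measure (Cube d)).prod volume).prod P) :=
    (m1.mul (RCLike.continuous_conj.comp_aestronglyMeasurable m2)).mul hvv.1.comp_fst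
  rw [integrable_prod_iff hm]
  refine ⟨.of_forall fun z => ?_, ?_⟩
  · have : Integrable (fun ω => Y z.1 ω * conj (Y z.2 ω)) P :=
      (hY.memLp z.1).integrable_mul (hY.memLp z.2).star
    exact this.mul_const (conj (v z.1) * v z.2)
  · refine Integrable.mono' (hvv.norm.const_mul Λ) hm.norm.integral_prod_right'
      (.of_forall fun z => ?_)
    rw [Real.norm_of_nonneg (integral_nonneg fun _ => norm_nonneg _)]
    simp only [norm_mul, RCLike.norm_conj, integral_mul_const]
    exact mul_le_mul_of_nonneg_right (hY.integral_norm_mul_le hC z.1 z.2) (by positivity)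

theorem integrable_norm_sq_integral (hY : IsCenteredField P Y C) (hC : ∀ t, C t t = Λ)
    (v : Lp 𝕜 2 (volume : Measure (Cube d))) :
    Integrable (fun ω => ‖∫ t, Y t ω * conj (v t)‖ ^ 2) P := by
  have h := (hY.integrable_mul_conj_mul hC v).integral_prod_right
  simp only [integral_mul_conj_mul_eq] at h
  simpa using h.re

theorem integral_norm_sq_integral (hY : IsCenteredField P Y C) (hC : ∀ t, C t t = Λ)
    (v : Lp 𝕜 2 (volume : Measure (Cube d))) :
    ((∫ ω, ‖∫ t, Y t ω * conj (v t)‖ ^ 2 ∂P : ℝ) : 𝕜) =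
      ∫ z : Cube d × Cube d, ((C z.1 z.2 : ℝ) : 𝕜) * (conj (v z.1) * v z.2)
        ∂((volume : Measure (Cube d)).prod volume) := by
  have h := integral_integral_swap (f := fun (z : Cube d × Cube d) ω =>
    (Y z.1 ω * conj (Y z.2 ω)) * (conj (v z.1) * v z.2)) (hY.integrable_mul_conj_mul hC v)
  simp only [integral_mul_const, hY.cov] at h
  simp only [integral_mul_conj_mul_eq, integral_ofReal] at h
  exact h.symm

end IsCenteredField

/-- The error of a rank `n` approximation is at least the squared distance to the span. -/
theorem exists_orthonormal_sub_le_norm_sub_sum_sq {𝕜 E : Type*} [RCLike 𝕜] [NormedAddCommGroup E]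
    [InnerProductSpace 𝕜 E] {n : ℕ} (ψ : Fin n → E) :
    ∃ m ≤ n, ∃ v : Fin m → E, Orthonormal 𝕜 v ∧ ∀ (y : E) (a : Fin n → 𝕜),
      ‖y‖ ^ 2 - ∑ i, ‖inner 𝕜 (v i) y‖ ^ 2 ≤ ‖y - ∑ i, a i • ψ i‖ ^ 2 := by
  set V := Submodule.span 𝕜 (Set.range ψ) with hV
  have : FiniteDimensional 𝕜 V := FiniteDimensional.span_of_finite 𝕜 (Set.finite_range ψ)
  set b := stdOrthonormalBasis 𝕜 V
  refine ⟨Module.finrank 𝕜 V, ?_, fun i => (b i : E), ?_, fun y a => ?_⟩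
  · simpa [Set.finrank] using finrank_range_le_card (R := 𝕜) ψ
  · exact b.orthonormal.comp_linearIsometry V.subtypeₗᵢ
  · set u := ∑ i, a i • ψ i
    have hu : u ∈ V := Submodule.sum_mem _ fun i _ =>
      Submodule.smul_mem _ _ (Submodule.subset_span ⟨i, rfl⟩)
    have h1 := Submodule.norm_sq_eq_add_norm_sq_projection y V
    have h2 := b.sum_sq_norm_inner_right (V.orthogonalProjectionOnto y)
    have h3 : ∀ i, inner 𝕜 (b i) (V.orthogonalProjectionOnto y) = inner 𝕜 (b i : E) y := fun i => by
      simp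
    have h4 : Vᗮ.orthogonalProjectionOnto y = Vᗮ.orthogonalProjectionOnto (y - u) := by
      rw [map_sub, Submodule.orthogonalProjectionOnto_orthogonal_apply_eq_zero hu, sub_zero]
    have h5 : ‖Vᗮ.orthogonalProjectionOnto (y - u)‖ ≤ ‖y - u‖ :=
      Submodule.norm_orthogonalProjectionOnto_apply_le _ _
    simp only [h3] at h2
    rw [h2, h1, h4]
    nlinarith [norm_nonneg (Vᗮ.orthogonalProjectionOnto (y - u))]

theorem norm_sub_sum_inner_smul_sq {𝕜 E : Type*} [RCLike 𝕜] [NormedAddCommGroup E]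
    [InnerProductSpace 𝕜 E] {n : ℕ} {ψ : Fin n → E} (hψ : Orthonormal 𝕜 ψ) (y : E) :
    ‖y - ∑ i, inner 𝕜 (ψ i) y • ψ i‖ ^ 2 = ‖y‖ ^ 2 - ∑ i, ‖inner 𝕜 (ψ i) y‖ ^ 2 := by
  set u := ∑ i, inner 𝕜 (ψ i) y • ψ i with hu
  have h1 : inner 𝕜 u (y - u) = 0 := by
    rw [hu, sum_inner]
    refine Finset.sum_eq_zero fun i _ => ?_
    rw [inner_smul_left, inner_sub_right, hψ.inner_right_fintype, sub_self, mul_zero]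
  have h2 : ‖u‖ ^ 2 = ∑ i, ‖inner 𝕜 (ψ i) y‖ ^ 2 := by
    have h := hψ.inner_sum (fun i => inner 𝕜 (ψ i) y) (fun i => inner 𝕜 (ψ i) y) Finset.univ
    rw [← hu, inner_self_eq_norm_sq_to_K] at h
    simp only [RCLike.conj_mul] at h
    exact_mod_cast h
  have h3 := norm_add_sq_eq_norm_sq_add_norm_sq_of_inner_eq_zero u (y - u) h1
  rw [add_sub_cancel] at h3
  nlinarith

/-! ### Mean square error of finite rank approximations -/

section RankApprox

variable {𝕜 : Type*} [RCLike 𝕜] {Ω : Type*} [MeasurableSpace Ω] {P : Measure Ω} {d : ℕ}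
  {Y : Cube d → Ω → 𝕜} {C : Cube d → Cube d → ℝ} {Λ : ℝ}

theorem lintegral_enorm_sq_eq_ofReal {X : Type*} [MeasurableSpace X] {μ : Measure X}
    {F : X → 𝕜} (f : Lp 𝕜 2 μ) (h : F =ᵐ[μ] f) : ∫⁻ t, ‖F t‖ₑ ^ 2 ∂μ = ENNReal.ofReal (‖f‖ ^ 2) := by
  have h1 : ∫⁻ t, ‖F t‖ₑ ^ 2 ∂μ = ∫⁻ t, ‖f t‖ₑ ^ 2 ∂μ :=
    lintegral_congr_ae (h.mono fun t ht => by simp only [ht])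
  have h2 := eLpNorm_eq_lintegral_rpow_enorm_toReal (μ := μ) (p := 2) (f := (f : X → 𝕜))
    (by norm_num) (by norm_num)
  have h3 : ∫⁻ t, ‖f t‖ₑ ^ 2 ∂μ = eLpNorm f 2 μ ^ 2 := by
    rw [h2, ← ENNReal.rpow_natCast, ← ENNReal.rpow_mul]
    simp
  rw [h1, h3, Lp.norm_def, ENNReal.ofReal_pow ENNReal.toReal_nonneg,
    ENNReal.ofReal_toReal (Lp.eLpNorm_ne_top f)]

theorem inner_toLp_eq {X : Type*} [MeasurableSpace X] {μ : Measure X} {F : X → 𝕜}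
    (hF : MemLp F 2 μ) (v : Lp 𝕜 2 μ) :
    inner 𝕜 v (hF.toLp F) = ∫ t, F t * conj (v t) ∂μ := by
  rw [L2.inner_def]
  refine integral_congr_ae ?_
  filter_upwards [hF.coeFn_toLp] with t ht
  rw [ht, RCLike.inner_apply]

theorem norm_toLp_sq_eq {X : Type*} [MeasurableSpace X] {μ : Measure X} {F : X → 𝕜}
    (hF : MemLp F 2 μ) : ‖hF.toLp F‖ ^ 2 = ∫ t, ‖F t‖ ^ 2 ∂μ := by
  have h := lintegral_enorm_sq_eq_ofReal (hF.toLp F) hF.coeFn_toLp.symm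
  rw [integral_eq_lintegral_of_nonneg_ae (f := fun t => ‖F t‖ ^ 2)
    (.of_forall fun t => by positivity) (hF.1.norm.pow 2)]
  have h2 : ∀ t, ENNReal.ofReal (‖F t‖ ^ 2) = ‖F t‖ₑ ^ 2 := fun t => by
    rw [ENNReal.ofReal_pow (norm_nonneg _), ofReal_norm]
  simp only [h2, h]
  rw [ENNReal.toReal_ofReal (by positivity)]

theorem lintegral_sub_rankApprox_sq {Ω : Type*} {Y : Cube d → Ω → 𝕜} {n : ℕ}
    (ψ : Fin n → Lp 𝕜 2 (volume : Measure (Cube d)))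
    {ω : Ω} (hω : MemLp (fun t => Y t ω) 2 volume) :
    ∫⁻ t, ‖Y t ω - rankApprox Y ψ t ω‖ₑ ^ 2 =
      ENNReal.ofReal (‖hω.toLp _ - ∑ m, inner 𝕜 (ψ m) (hω.toLp _) • ψ m‖ ^ 2) := by
  refine lintegral_enorm_sq_eq_ofReal _ ?_
  have h1 : ∀ m, ⇑(inner 𝕜 (ψ m) (hω.toLp _) • ψ m) =ᵐ[volume]
      fun t => inner 𝕜 (ψ m) (hω.toLp _) * ψ m t := fun m => Lp.coeFn_smul _ _
  have h2 : ⇑(∑ m, inner 𝕜 (ψ m) (hω.toLp _) • ψ m) =ᵐ[volume]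
      ∑ m, ⇑(inner 𝕜 (ψ m) (hω.toLp _) • ψ m) := Lp.coeFn_finsetSum _ _
  filter_upwards [hω.coeFn_toLp, Lp.coeFn_sub (hω.toLp _)
    (∑ m, inner 𝕜 (ψ m) (hω.toLp _) • ψ m), eventually_all.2 h1, h2] with t ht1 ht2 ht3 ht4
  rw [ht2, Pi.sub_apply, ht1, ht4, Finset.sum_apply, rankApprox]
  congr 1
  refine Finset.sum_congr rfl fun m _ => ?_
  rw [ht3, inner_toLp_eq]

namespace IsCenteredField

variable [IsProbabilityMeasure P]

/-- Bessel's inequality makes the integrand nonnegative along almost every path, so the extended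
integral agrees with the Bochner integral and linearity applies. -/
theorem lintegral_ofReal_sub_sum (hY : IsCenteredField P Y C) (hC : ∀ t, C t t = Λ) {n : ℕ}
    {ψ : Fin n → Lp 𝕜 2 (volume : Measure (Cube d))} (hψ : Orthonormal 𝕜 ψ) :
    ∫⁻ ω, ENNReal.ofReal ((∫ t, ‖Y t ω‖ ^ 2) - ∑ m, ‖∫ t, Y t ω * conj (ψ m t)‖ ^ 2) ∂P =
      ENNReal.ofReal (Λ - ∑ m, ∫ ω, ‖∫ t, Y t ω * conj (ψ m t)‖ ^ 2 ∂P) := by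
  have hi := hY.integrable_integral_norm_sq hC
  have hs : ∀ m ∈ Finset.univ, Integrable (fun ω => ‖∫ t, Y t ω * conj (ψ m t)‖ ^ 2) P :=
    fun m _ => hY.integrable_norm_sq_integral hC (ψ m)
  have h := ofReal_integral_eq_lintegral_ofReal (f := fun ω => (∫ t, ‖Y t ω‖ ^ 2) -
    ∑ m, ‖∫ t, Y t ω * conj (ψ m t)‖ ^ 2) (hi.sub (integrable_finsetSum _ hs)) ?_
  · rw [← h, integral_sub hi (integrable_finsetSum _ hs), integral_finsetSum _ hs,
      hY.integral_integral_norm_sq hC]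
  filter_upwards [hY.memLp_path hC] with ω hω
  have h := hψ.sum_inner_products_le (hω.toLp _) (s := Finset.univ)
  simp only [inner_toLp_eq, norm_toLp_sq_eq] at h
  simpa using h

theorem lintegral_sub_rankApprox_of_orthonormal (hY : IsCenteredField P Y C)
    (hC : ∀ t, C t t = Λ) {n : ℕ} {ψ : Fin n → Lp 𝕜 2 (volume : Measure (Cube d))}
    (hψ : Orthonormal 𝕜 ψ) :
    ∫⁻ ω, ∫⁻ t, ‖Y t ω - rankApprox Y ψ t ω‖ₑ ^ 2 ∂volume ∂P =
      ENNReal.ofReal (Λ - ∑ m, ∫ ω, ‖∫ t, Y t ω * conj (ψ m t)‖ ^ 2 ∂P) := by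
  rw [← hY.lintegral_ofReal_sub_sum hC hψ]
  refine lintegral_congr_ae ?_
  filter_upwards [hY.memLp_path hC] with ω hω
  rw [lintegral_sub_rankApprox_sq ψ hω, norm_sub_sum_inner_smul_sq hψ, norm_toLp_sq_eq]
  simp only [inner_toLp_eq]

theorem exists_orthonormal_le_lintegral_sub_rankApprox (hY : IsCenteredField P Y C)
    (hC : ∀ t, C t t = Λ) {n : ℕ} (ψ : Fin n → Lp 𝕜 2 (volume : Measure (Cube d))) :
    ∃ m ≤ n, ∃ v : Fin m → Lp 𝕜 2 (volume : Measure (Cube d)), Orthonormal 𝕜 v ∧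
      ENNReal.ofReal (Λ - ∑ i, ∫ ω, ‖∫ t, Y t ω * conj (v i t)‖ ^ 2 ∂P) ≤
        ∫⁻ ω, ∫⁻ t, ‖Y t ω - rankApprox Y ψ t ω‖ₑ ^ 2 ∂volume ∂P := by
  obtain ⟨m, hm, v, hv, h⟩ := exists_orthonormal_sub_le_norm_sub_sum_sq (𝕜 := 𝕜) ψ
  refine ⟨m, hm, v, hv, ?_⟩
  rw [← hY.lintegral_ofReal_sub_sum hC hv]
  refine lintegral_mono_ae ?_
  filter_upwards [hY.memLp_path hC] with ω hω
  rw [lintegral_sub_rankApprox_sq ψ hω]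
  refine ENNReal.ofReal_le_ofReal ?_
  have := h (hω.toLp _) fun m => inner 𝕜 (ψ m) (hω.toLp _)
  rw [norm_toLp_sq_eq] at this
  simpa only [inner_toLp_eq] using this

end IsCenteredField

/-- Diagonalization of the quadratic form of a kernel given as a series of products. -/
theorem hasSum_norm_sq_inner_of_hasSum_kernel {X ι : Type*} [MeasurableSpace X] [Countable ι]
    {μ : Measure X} [IsFiniteMeasure μ] {w : ι → ℝ} (hw : Summable w) (hw0 : ∀ i, 0 ≤ w i)
    {g : ι → X → ℝ} (hg : ∀ i, MemLp (fun t => (g i t : 𝕜)) 2 μ) (hg1 : ∀ i t, |g i t| ≤ 1)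
    {C : X → X → ℝ} (hC : ∀ t s, HasSum (fun i => w i * (g i t * g i s)) (C t s))
    (v : Lp 𝕜 2 μ) {q : ℝ}
    (hq : (q : 𝕜) = ∫ z : X × X, ((C z.1 z.2 : ℝ) : 𝕜) * (conj (v z.1) * v z.2) ∂(μ.prod μ)) :
    HasSum (fun i => w i * ‖inner 𝕜 v ((hg i).toLp _)‖ ^ 2) q := by
  have hv : Integrable v μ := (Lp.memLp v).integrable (by norm_num)
  have hv1 : Integrable (fun t => conj (v t)) μ :=
    (RCLike.conjCLE (K := 𝕜)).toContinuousLinearMap.integrable_comp hv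
  have hvv : Integrable (fun z : X × X => conj (v z.1) * v z.2) (μ.prod μ) := hv1.mul_prod hv
  have hgm : ∀ i, AEStronglyMeasurable (fun z : X × X => (g i z.1 : 𝕜) * (g i z.2 : 𝕜))
      (μ.prod μ) := fun i => (hg i).1.comp_fst.mul (hg i).1.comp_snd
  have hle : ∀ i (z : X × X), ‖(w i : 𝕜) * ((g i z.1 : 𝕜) * (g i z.2 : 𝕜))‖ ≤ w i := by
    intro i z
    rw [norm_mul, norm_mul, RCLike.norm_ofReal, RCLike.norm_ofReal, RCLike.norm_ofReal,
      abs_of_nonneg (hw0 i)]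
    exact mul_le_of_le_one_right (hw0 i)
      (mul_le_one₀ (hg1 i _) (abs_nonneg _) (hg1 i _))
  set F : ι → X × X → 𝕜 := fun i z =>
    ((w i : 𝕜) * ((g i z.1 : 𝕜) * (g i z.2 : 𝕜))) * (conj (v z.1) * v z.2) with hF
  have hFi : ∀ i, Integrable (F i) (μ.prod μ) := fun i =>
    hvv.bdd_mul ((hgm i).const_mul _) (.of_forall (hle i))
  have hFs : Summable fun i => ∫ z, ‖F i z‖ ∂(μ.prod μ) := by
    refine Summable.of_nonneg_of_le (fun i => integral_nonneg fun _ => norm_nonneg _)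
      (fun i => ?_) (hw.mul_right (∫ z : X × X, ‖conj (v z.1) * v z.2‖ ∂(μ.prod μ)))
    rw [← integral_const_mul]
    refine integral_mono (hFi i).norm (hvv.norm.const_mul _) fun z => ?_
    simp only [hF]
    rw [norm_mul]
    exact mul_le_mul_of_nonneg_right (hle i z) (norm_nonneg _)
  have h1 := hasSum_integral_of_summable_integral_norm hFi hFs
  have h2 : ∀ z : X × X, ∑' i, F i z = ((C z.1 z.2 : ℝ) : 𝕜) * (conj (v z.1) * v z.2) := by
    intro z
    have := ((RCLike.hasSum_ofReal (𝕜 := 𝕜)).2 (hC z.1 z.2)).mul_right (conj (v z.1) * v z.2)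
    rw [← this.tsum_eq]
    simp [hF]
  have h3 : ∀ i, ∫ z, F i z ∂(μ.prod μ) =
      ((w i * ‖inner 𝕜 v ((hg i).toLp _)‖ ^ 2 : ℝ) : 𝕜) := by
    intro i
    have h := integral_prod_mul (μ := μ) (ν := μ)
      (fun t => (g i t : 𝕜) * conj (v t)) (fun t => conj ((g i t : 𝕜) * conj (v t)))
    rw [integral_conj, RCLike.mul_conj, ← inner_toLp_eq (hg i) v] at h
    push_cast
    rw [← h, ← integral_const_mul]
    refine integral_congr_ae (.of_forall fun z => ?_)
    simp only [hF, map_mul, RCLike.conj_conj, RCLike.conj_ofReal]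
    ring
  simp only [h2, h3, ← hq] at h1
  exact (RCLike.hasSum_ofReal (𝕜 := 𝕜)).1 h1

end RankApprox

/-! ### Error bounds from a series expansion of the covariance -/

section KernelSeries

variable {𝕜 : Type*} [RCLike 𝕜]

/-- The trace of a kernel given as a series of products. -/
theorem hasSum_norm_sq_of_hasSum_kernel {X ι : Type*} [MeasurableSpace X] [Countable ι]
    {μ : Measure X} [IsProbabilityMeasure μ] {w : ι → ℝ} (hw : Summable w) (hw0 : ∀ i, 0 ≤ w i)
    {g : ι → X → ℝ} (hg : ∀ i, MemLp (fun t => (g i t : 𝕜)) 2 μ) (hg1 : ∀ i t, |g i t| ≤ 1)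
    {Λ : ℝ} (hΛ : ∀ t, HasSum (fun i => w i * (g i t * g i t)) Λ) :
    HasSum (fun i => w i * ‖(hg i).toLp _‖ ^ 2) Λ := by
  have hn : ∀ i, ‖(hg i).toLp _‖ ^ 2 = ∫ t, g i t * g i t ∂μ := fun i => by
    rw [norm_toLp_sq_eq]
    simp only [RCLike.norm_ofReal, sq, abs_mul_abs_self]
  have hi : ∀ i, Integrable (fun t => w i * (g i t * g i t)) μ := fun i => by
    have := (memLp_two_iff_integrable_sq_norm (hg i).1).1 (hg i)
    simp only [RCLike.norm_ofReal, sq, abs_mul_abs_self] at this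
    exact this.const_mul (w i)
  have hle : ∀ i t, ‖w i * (g i t * g i t)‖ ≤ w i := fun i t => by
    rw [norm_mul, norm_mul, Real.norm_of_nonneg (hw0 i)]
    exact mul_le_of_le_one_right (hw0 i) (mul_le_one₀ (hg1 i t) (abs_nonneg _) (hg1 i t))
  have hs : Summable fun i => ∫ t, ‖w i * (g i t * g i t)‖ ∂μ := by
    refine Summable.of_nonneg_of_le (fun i => integral_nonneg fun _ => norm_nonneg _)
      (fun i => ?_) hw
    have := integral_mono (hi i).norm (integrable_const (μ := μ) (w i)) (hle i)
    simpa using this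
  have h := hasSum_integral_of_summable_integral_norm hi hs
  simp only [(hΛ _).tsum_eq, integral_const_mul, ← hn] at h
  simpa using h

section Expansion

variable {Ω ι : Type*} [MeasurableSpace Ω] {P : Measure Ω} [IsProbabilityMeasure P] [Countable ι]
  {d : ℕ} {Y : Cube d → Ω → 𝕜} {C : Cube d → Cube d → ℝ} {Λ : ℝ} {w : ι → ℝ}
  {g : ι → Cube d → ℝ}

theorem IsCenteredField.hasSum_integral_norm_sq_integral (hY : IsCenteredField P Y C)
    (hΛ : ∀ t, C t t = Λ)
    (hw : Summable w) (hw0 : ∀ i, 0 ≤ w i)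
    (hg : ∀ i, MemLp (fun t => (g i t : 𝕜)) 2 volume) (hg1 : ∀ i t, |g i t| ≤ 1)
    (hC : ∀ t s, HasSum (fun i => w i * (g i t * g i s)) (C t s))
    (v : Lp 𝕜 2 (volume : Measure (Cube d))) :
    HasSum (fun i => w i * ‖inner 𝕜 v ((hg i).toLp _)‖ ^ 2)
      (∫ ω, ‖∫ t, Y t ω * conj (v t)‖ ^ 2 ∂P) :=
  hasSum_norm_sq_inner_of_hasSum_kernel hw hw0 hg hg1 hC v (hY.integral_norm_sq_integral hΛ v)

/-- Weak duality for choosing `n` directions, with `θ` as the multiplier of the rank constraint.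
Only the functions indexed by `S` need to be orthogonal, so the expansion need not be a
diagonalization. -/
theorem IsCenteredField.le_lintegral_sub_rankApprox (hY : IsCenteredField P Y C)
    (hΛ : ∀ t, C t t = Λ)
    (hw : Summable w) (hw0 : ∀ i, 0 ≤ w i)
    (hg : ∀ i, MemLp (fun t => (g i t : 𝕜)) 2 volume) (hg1 : ∀ i t, |g i t| ≤ 1)
    (hC : ∀ t s, HasSum (fun i => w i * (g i t * g i s)) (C t s))
    (S : Finset ι) (hS : Orthonormal 𝕜 fun i : S => ((√2 : ℝ) : 𝕜) • (hg i).toLp _)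
    {θ : ℝ} (hθ : 0 ≤ θ) {n : ℕ} (ψ : Fin n → Lp 𝕜 2 (volume : Measure (Cube d))) :
    ENNReal.ofReal ((∑ i ∈ S, min (w i) θ - θ * n) / 2) ≤
      ∫⁻ ω, ∫⁻ t, ‖Y t ω - rankApprox Y ψ t ω‖ₑ ^ 2 ∂volume ∂P := by
  obtain ⟨m, hm, v, hv, h⟩ := hY.exists_orthonormal_le_lintegral_sub_rankApprox hΛ ψ
  refine le_trans (ENNReal.ofReal_le_ofReal ?_) h
  set G : ι → Lp 𝕜 2 (volume : Measure (Cube d)) := fun i => (hg i).toLp _ with hG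
  have hsq : ‖((√2 : ℝ) : 𝕜)‖ ^ 2 = 2 := by simp
  have h1 := hasSum_norm_sq_of_hasSum_kernel hw hw0 hg hg1 (fun t => hΛ t ▸ hC t t)
  have h2 := hasSum_sum (s := Finset.univ) fun m _ =>
    hY.hasSum_integral_norm_sq_integral hΛ hw hw0 hg hg1 hC (v m)
  have h3 := h1.sub h2
  simp only [← Finset.mul_sum, ← mul_sub] at h3
  have hbes : ∀ i, ∑ m, ‖inner 𝕜 (v m) (G i)‖ ^ 2 ≤ ‖G i‖ ^ 2 := fun i =>
    hv.sum_inner_products_le (G i) (s := Finset.univ)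
  -- By Bessel every term of the residual series is nonnegative, so the terms outside `S` can be
  -- dropped.
  have h4 := sum_le_hasSum S
    (fun i _ => mul_nonneg (hw0 i) (sub_nonneg.2 (hbes i))) h3
  refine le_trans ?_ h4
  have hnorm : ∀ i ∈ S, ‖G i‖ ^ 2 = 1 / 2 := fun i hi => by
    have := hS.1 ⟨i, hi⟩
    simp only [norm_smul] at this
    have h5 : ‖((√2 : ℝ) : 𝕜)‖ ^ 2 * ‖G i‖ ^ 2 = 1 := by rw [← mul_pow, this, one_pow]
    rw [hsq] at h5
    linarith
  -- Bessel for the system `√2 • G i`: each of the `m ≤ n` unit vectors `v k` contributes at most `1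
  -- / 2`.
  have hp : ∑ i ∈ S, ∑ m, ‖inner 𝕜 (v m) (G i)‖ ^ 2 ≤ (n : ℝ) / 2 := by
    rw [Finset.sum_comm]
    have : ∀ k ∈ (Finset.univ : Finset (Fin m)),
        ∑ i ∈ S, ‖inner 𝕜 (v k) (G i)‖ ^ 2 ≤ (1 / 2 : ℝ) := fun k _ => by
      have h5 := hS.sum_inner_products_le (v k) (s := Finset.univ)
      rw [hv.1 k] at h5
      simp only [inner_smul_left, norm_mul, mul_pow, RCLike.norm_conj, hsq,
        ← Finset.mul_sum] at h5
      rw [← Finset.sum_coe_sort]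
      simp only [norm_inner_symm (v k)]
      linarith
    refine (Finset.sum_le_sum this).trans ?_
    simp only [Finset.sum_const, Finset.card_univ, Fintype.card_fin, nsmul_eq_mul]
    have : (m : ℝ) ≤ n := by exact_mod_cast hm
    linarith
  -- With `p` the inner sum, `0 ≤ p ≤ 1/2`, so `w (1/2 - p) ≥ min(w, θ) (1/2 - p) ≥ min(w, θ) / 2 -
  -- θ p`.
  have h6 : ∑ i ∈ S, (min (w i) θ / 2 - θ * ∑ m, ‖inner 𝕜 (v m) (G i)‖ ^ 2) ≤
      ∑ i ∈ S, w i * (‖G i‖ ^ 2 - ∑ m, ‖inner 𝕜 (v m) (G i)‖ ^ 2) := by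
    refine Finset.sum_le_sum fun i hi => ?_
    have h7 := hbes i
    have h8 : 0 ≤ ∑ m, ‖inner 𝕜 (v m) (G i)‖ ^ 2 := by positivity
    rw [hnorm i hi] at h7 ⊢
    have h9 := mul_le_mul_of_nonneg_right (min_le_left (w i) θ) (sub_nonneg.2 h7)
    have h10 := mul_le_mul_of_nonneg_right (min_le_right (w i) θ) h8
    linarith
  refine le_trans ?_ h6
  rw [Finset.sum_sub_distrib, ← Finset.mul_sum, ← Finset.sum_div]
  have := mul_le_mul_of_nonneg_left hp hθ
  linarith

theorem IsCenteredField.averageError_zero (hY : IsCenteredField P Y C)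
    (hΛ : ∀ t, C t t = Λ) : averageError P Y 0 = ENNReal.ofReal Λ ^ (1 / 2 : ℝ) := by
  rw [averageError, iInf_unique,
    hY.lintegral_sub_rankApprox_of_orthonormal hΛ (Orthonormal.of_isEmpty _)]
  simp

/-- Lower bounds `lam` for the captured variances suffice, so the higher frequencies never have to
be evaluated. -/
theorem IsCenteredField.averageError_card_le (hY : IsCenteredField P Y C)
    (hΛ : ∀ t, C t t = Λ) {κ : Type*} [Fintype κ] {e : κ → Lp 𝕜 2 (volume : Measure (Cube d))}
    (he : Orthonormal 𝕜 e) {lam : κ → ℝ}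
    (hlam : ∀ k, lam k ≤ ∫ ω, ‖∫ t, Y t ω * conj (e k t)‖ ^ 2 ∂P) :
    averageError P Y (Fintype.card κ) ≤ ENNReal.ofReal (Λ - ∑ k, lam k) ^ (1 / 2 : ℝ) := by
  set ψ : Fin (Fintype.card κ) → Lp 𝕜 2 (volume : Measure (Cube d)) :=
    e ∘ (Fintype.equivFin κ).symm with hψ
  refine (iInf_le _ ψ).trans (ENNReal.rpow_le_rpow ?_ (by norm_num))
  rw [hY.lintegral_sub_rankApprox_of_orthonormal hΛ (he.comp _ (Equiv.injective _))]
  refine ENNReal.ofReal_le_ofReal (sub_le_sub_left ?_ _)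
  rw [← (Fintype.equivFin κ).symm.sum_comp]
  exact Finset.sum_le_sum fun m _ => hlam _

end Expansion

end KernelSeries

/-! ### Trigonometric expansion of the additive Korobov kernel -/

noncomputable section

/-- The eigenvalue weights of the additive Korobov kernel, indexed by coordinate, frequency and
parity. -/
def korobovWeight (α β σ : ℕ → ℝ) (d : ℕ) (i : Fin d × ℕ × Bool) : ℝ :=
  if i.2.1 = 0 then α (i.1 + 1) else 2 * β (i.1 + 1) * (i.2.1 : ℝ) ^ (-σ (i.1 + 1))

/-- `cos (2 π k t)` or `sin (2 π k t)`. -/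
def trigFun (k : ℕ) (b : Bool) (t : ℝ) : ℝ :=
  bif b then Real.cos (2 * Real.pi * k * t) else Real.sin (2 * Real.pi * k * t)

/-- The trigonometric functions of one coordinate of the cube. -/
def cubeTrig (d : ℕ) (i : Fin d × ℕ × Bool) (t : Cube d) : ℝ := trigFun i.2.1 i.2.2 (t i.1)

/-- The trace of the Korobov kernel. -/
def korobovTrace (α β σ : ℝ) : ℝ := α + 2 * β * ∑' k : ℕ, ((k + 1 : ℕ) : ℝ) ^ (-σ)

end

theorem abs_trigFun_le_one (k : ℕ) (b : Bool) (t : ℝ) : |trigFun k b t| ≤ 1 := by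
  cases b
  · exact Real.abs_sin_le_one _
  · exact Real.abs_cos_le_one _

theorem continuous_trigFun (k : ℕ) (b : Bool) : Continuous (trigFun k b) := by
  cases b
  · exact Real.continuous_sin.comp (continuous_const.mul continuous_id)
  · exact Real.continuous_cos.comp (continuous_const.mul continuous_id)

theorem sum_trigFun_mul (k : ℕ) (t s : ℝ) :
    ∑ b, trigFun k b t * trigFun k b s = Real.cos (2 * Real.pi * k * (t - s)) := by
  rw [mul_sub, Real.cos_sub]
  simp [trigFun]

theorem continuous_cubeTrig (d : ℕ) (i : Fin d × ℕ × Bool) : Continuous (cubeTrig d i) :=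
  (continuous_trigFun _ _).comp (continuous_subtype_val.comp (continuous_apply _))

theorem memLp_cubeTrig (𝕜 : Type*) [RCLike 𝕜] (d : ℕ) (i : Fin d × ℕ × Bool) :
    MemLp (fun t => (cubeTrig d i t : 𝕜)) 2 (volume : Measure (Cube d)) :=
  MemLp.of_bound
    (RCLike.continuous_ofReal.comp (continuous_cubeTrig d i)).aestronglyMeasurable 1
    (.of_forall fun t => by
      rw [RCLike.norm_ofReal]
      exact abs_trigFun_le_one _ _ _)

section Kernel

variable {α β σ : ℕ → ℝ} (hα : ∀ j, 1 ≤ j → 0 < α j) (hβ : ∀ j, 1 ≤ j → 0 < β j)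
  (hσ : ∀ j, 1 ≤ j → 1 < σ j)

theorem summable_nat_add_one_rpow_neg {s : ℝ} (hs : 1 < s) :
    Summable fun k : ℕ => ((k + 1 : ℕ) : ℝ) ^ (-s) :=
  (summable_nat_add_iff 1).2 (Real.summable_nat_rpow.2 (neg_lt_neg hs))

include hα hβ in
theorem korobovWeight_nonneg (d : ℕ) (i : Fin d × ℕ × Bool) : 0 ≤ korobovWeight α β σ d i := by
  rw [korobovWeight]
  split_ifs
  · exact (hα _ (by omega)).le
  · exact mul_nonneg (mul_nonneg two_pos.le (hβ _ (by omega)).le) (by positivity)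

include hα hβ hσ in
theorem summable_korobovWeight (d : ℕ) : Summable (korobovWeight α β σ d) := by
  have h0 := korobovWeight_nonneg (σ := σ) hα hβ d
  rw [summable_prod_of_nonneg h0]
  refine ⟨fun j => ?_, Summable.of_finite⟩
  rw [summable_prod_of_nonneg fun i => h0 (j, i)]
  refine ⟨fun k => Summable.of_finite, ?_⟩
  simp only [tsum_fintype]
  rw [← summable_nat_add_iff 1]
  have := (summable_nat_add_one_rpow_neg (hσ (j + 1) (by omega))).mul_left (2 * β (j + 1))
  refine (this.mul_left 2).congr fun k => ?_
  simp [korobovWeight]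

include hα hβ hσ in
theorem hasSum_korobovWeight_mul (d : ℕ) (t s : Cube d) :
    HasSum (fun i => korobovWeight α β σ d i * (cubeTrig d i t * cubeTrig d i s))
      (additiveKorobovCov α β σ d t s) := by
  have h0 := korobovWeight_nonneg (σ := σ) hα hβ d
  have hsum : Summable fun i => korobovWeight α β σ d i * (cubeTrig d i t * cubeTrig d i s) := by
    refine Summable.of_norm_bounded (summable_korobovWeight hα hβ hσ d) fun i => ?_
    rw [norm_mul, norm_mul, Real.norm_of_nonneg (h0 i)]
    exact mul_le_of_le_one_right (h0 i)
      (mul_le_one₀ (abs_trigFun_le_one _ _ _) (abs_nonneg _) (abs_trigFun_le_one _ _ _))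
  have hfib : ∀ j : Fin d, ∑' x : ℕ × Bool,
      korobovWeight α β σ d (j, x) * (cubeTrig d (j, x) t * cubeTrig d (j, x) s) =
      korobovKernel (α (j + 1)) (β (j + 1)) (σ (j + 1)) (t j) (s j) := by
    intro j
    have hj := hsum.prod_factor j
    rw [hj.tsum_prod' fun k => Summable.of_finite]
    -- The weight does not depend on the parity, so the addition formula applies. At `k = 0` the
    -- sine vanishes, hence `α` is counted once although both parities carry it.
    have h2 : ∀ k : ℕ, ∑' b : Bool,
        korobovWeight α β σ d (j, k, b) * (cubeTrig d (j, k, b) t * cubeTrig d (j, k, b) s) =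
        korobovWeight α β σ d (j, k, true) * Real.cos (2 * Real.pi * k * (t j - s j)) := by
      intro k
      rw [tsum_fintype, ← sum_trigFun_mul, Finset.mul_sum]
      rfl
    have h3 := hj.prod
    simp only [h2] at h3 ⊢
    rw [h3.tsum_eq_zero_add, korobovKernel, ← tsum_mul_left]
    simp [korobovWeight, mul_assoc]
  convert hsum.hasSum using 1
  rw [hsum.tsum_prod, tsum_fintype, additiveKorobovCov]
  exact Finset.sum_congr rfl fun j _ => (hfib j).symm

theorem additiveKorobovCov_self (d : ℕ) (t : Cube d) :
    additiveKorobovCov α β σ d t t =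
      ∑ j ∈ Finset.range d, korobovTrace (α (j + 1)) (β (j + 1)) (σ (j + 1)) := by
  rw [Finset.sum_range]
  simp [additiveKorobovCov, korobovKernel, korobovTrace]

end Kernel

/-! ### Orthonormality of the constant and the frequency-one functions -/

section Orthonormality

theorem integral_unitInterval_eq (f : ℝ → ℝ) : ∫ t : unitInterval, f t = ∫ t in (0 : ℝ)..1, f t := by
  rw [intervalIntegral.integral_of_le zero_le_one, ← integral_Icc_eq_integral_Ioc]
  exact integral_subtype_comap measurableSet_Icc f

theorem integral_trigFun_one (b : Bool) : ∫ t : unitInterval, trigFun 1 b t = 0 := by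
  rw [integral_unitInterval_eq]
  have hpi := Real.pi_ne_zero
  cases b
  · simp [trigFun]
  · simp [trigFun]

theorem integral_trigFun_one_mul (b b' : Bool) :
    ∫ t : unitInterval, trigFun 1 b t * trigFun 1 b' t = if b = b' then 1 / 2 else 0 := by
  rw [integral_unitInterval_eq fun t => trigFun 1 b t * trigFun 1 b' t]
  have hpi := Real.pi_ne_zero
  have h1 := intervalIntegral.integral_comp_mul_left (a := 0) (b := 1)
    (fun x => Real.cos x * Real.cos x) (c := 2 * Real.pi) (by positivity)
  have h2 := intervalIntegral.integral_comp_mul_left (a := 0) (b := 1)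
    (fun x => Real.sin x * Real.sin x) (c := 2 * Real.pi) (by positivity)
  have h3 := intervalIntegral.integral_comp_mul_left (a := 0) (b := 1)
    (fun x => Real.sin x * Real.cos x) (c := 2 * Real.pi) (by positivity)
  simp only [← sq, integral_cos_sq, integral_sin_sq, integral_sin_mul_cos₁] at h1 h2 h3
  cases b <;> cases b' <;> simp [trigFun, ← sq, mul_comm (Real.cos _) (Real.sin _), h1, h2, h3] <;>
    field_simp

theorem integral_cubeTrig_one (d : ℕ) (j : Fin d) (b : Bool) :
    ∫ t, cubeTrig d (j, 1, b) t = 0 := by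
  have h := (measurePreserving_eval (fun _ : Fin d => (volume : Measure unitInterval)) j)
  rw [← integral_trigFun_one b, ← h.map_eq, integral_map h.aemeasurable]
  · rfl
  · exact ((continuous_trigFun 1 b).comp continuous_subtype_val).aestronglyMeasurable

theorem integral_cubeTrig_one_mul (d : ℕ) (j j' : Fin d) (b b' : Bool) :
    ∫ t, cubeTrig d (j, 1, b) t * cubeTrig d (j', 1, b') t =
      if (j, b) = (j', b') then 1 / 2 else 0 := by
  by_cases hj : j = j'
  · subst hj
    have h := (measurePreserving_eval (fun _ : Fin d => (volume : Measure unitInterval)) j)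
    have h2 := integral_trigFun_one_mul b b'
    rw [← h.map_eq, integral_map h.aemeasurable] at h2
    · simp only [Prod.mk.injEq, true_and]
      exact h2
    · exact (((continuous_trigFun 1 b).comp continuous_subtype_val).mul
        ((continuous_trigFun 1 b').comp continuous_subtype_val)).aestronglyMeasurable
  -- Distinct coordinates are independent under the product measure, so the integral factors into
  -- two vanishing means.
  · have hi := (ProbabilityTheory.iIndepFun_pi
      (μ := fun _ : Fin d => (volume : Measure unitInterval)) (X := fun _ x => x)
      fun _ => aemeasurable_id).indepFun hj
    have hi2 := hi.comp
      ((continuous_trigFun 1 b).comp continuous_subtype_val).measurable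
      ((continuous_trigFun 1 b').comp continuous_subtype_val).measurable
    have h := hi2.integral_fun_mul_eq_mul_integral
      (continuous_cubeTrig d (j, 1, b)).aestronglyMeasurable
      (continuous_cubeTrig d (j', 1, b')).aestronglyMeasurable
    rw [if_neg (by simp [hj])]
    exact h.trans (mul_eq_zero_of_left (integral_cubeTrig_one d j b) _)

variable (𝕜 : Type*) [RCLike 𝕜]

theorem inner_toLp_ofReal {X : Type*} [MeasurableSpace X] {μ : Measure X} {f g : X → ℝ}
    (hf : MemLp (fun t => (f t : 𝕜)) 2 μ) (hg : MemLp (fun t => (g t : 𝕜)) 2 μ) :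
    inner 𝕜 (hf.toLp _) (hg.toLp _) = ((∫ t, f t * g t ∂μ : ℝ) : 𝕜) := by
  rw [inner_toLp_eq, ← integral_ofReal]
  refine integral_congr_ae ?_
  filter_upwards [hf.coeFn_toLp] with t ht
  rw [ht]
  simp [mul_comm]

theorem orthonormal_sqrt_two_smul_cubeTrig (d : ℕ) :
    Orthonormal 𝕜 fun x : Fin d × Bool =>
      ((√2 : ℝ) : 𝕜) • (memLp_cubeTrig 𝕜 d (x.1, 1, x.2)).toLp _ := by
  rw [orthonormal_iff_ite]
  rintro ⟨j, b⟩ ⟨j', b'⟩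
  rw [inner_smul_left, inner_smul_right, inner_toLp_ofReal, integral_cubeTrig_one_mul,
    RCLike.conj_ofReal, ← mul_assoc, ← RCLike.ofReal_mul, Real.mul_self_sqrt two_pos.le]
  split_ifs <;> simp

theorem orthonormal_option_cubeTrig (d : ℕ) :
    Orthonormal 𝕜 fun x : Option (Fin d × Bool) =>
      x.elim ((memLp_const (1 : 𝕜)).toLp _ : Lp 𝕜 2 (volume : Measure (Cube d))) fun x =>
        ((√2 : ℝ) : 𝕜) • (memLp_cubeTrig 𝕜 d (x.1, 1, x.2)).toLp _ := by
  have h1 : MemLp (fun _ : Cube d => ((1 : ℝ) : 𝕜)) 2 volume := memLp_const _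
  have h2 : ((memLp_const (1 : 𝕜)).toLp _ : Lp 𝕜 2 (volume : Measure (Cube d))) = h1.toLp _ := by
    simp
  have h3 := orthonormal_iff_ite.1 (orthonormal_sqrt_two_smul_cubeTrig 𝕜 d)
  rw [orthonormal_iff_ite]
  rintro (_ | x) (_ | y)
  · simp only [Option.elim, h2, inner_toLp_ofReal]
    simp
  · simp only [Option.elim, h2, inner_smul_right, inner_toLp_ofReal, one_mul,
      integral_cubeTrig_one]
    simp
  · simp only [Option.elim, h2, inner_smul_left, inner_toLp_ofReal, mul_one,
      integral_cubeTrig_one]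
    simp
  · simpa using h3 x y

end Orthonormality

theorem korobovTrace_pos {a b s : ℝ} (ha : 0 < a) (hb : 0 ≤ b) : 0 < korobovTrace a b s :=
  add_pos_of_pos_of_nonneg ha (mul_nonneg (mul_nonneg two_pos.le hb)
    (tsum_nonneg fun _ => by positivity))

theorem ENNReal.ofReal_mul_ofReal_rpow_half {ε : ℝ} (hε : 0 ≤ ε) (x : ℝ) :
    ENNReal.ofReal ε * ENNReal.ofReal x ^ (1 / 2 : ℝ) =
      ENNReal.ofReal (ε ^ 2 * x) ^ (1 / 2 : ℝ) := by
  rw [ENNReal.ofReal_mul (by positivity), ENNReal.mul_rpow_of_nonneg _ _ (by norm_num),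
    ENNReal.ofReal_pow hε, ← ENNReal.rpow_natCast, ← ENNReal.rpow_mul]
  simp

/-! ### Two-sided error bounds for the Korobov field -/

section Complexity

variable {𝕜 : Type*} [RCLike 𝕜] {α β σ : ℕ → ℝ} (hα : ∀ j, 1 ≤ j → 0 < α j)
  (hβ : ∀ j, 1 ≤ j → 0 < β j) (hσ : ∀ j, 1 ≤ j → 1 < σ j)
  {Ω : Type*} [MeasurableSpace Ω] {P : Measure Ω} [IsProbabilityMeasure P] {d : ℕ}
  {Y : Cube d → Ω → 𝕜} (hY : IsCenteredField P Y (additiveKorobovCov α β σ d))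

include hα hβ hσ hY

/-- The dual bound is applied to frequency one only, whose weights are `2 β`, with multiplier `2 θ`.
The two parities and the final division by two leave the factor `2` before the sum. -/
theorem korobov_averageError_lower {θ : ℝ} (hθ : 0 ≤ θ) (n : ℕ) :
    ENNReal.ofReal (2 * ∑ j ∈ Finset.range d, min (β (j + 1)) θ - θ * n) ^ (1 / 2 : ℝ) ≤
      averageError P Y n := by
  refine le_iInf fun ψ => ENNReal.rpow_le_rpow ?_ (by norm_num)
  obtain ⟨f, hf⟩ : ∃ f : Fin d × Bool ↪ Fin d × ℕ × Bool, ∀ x, f x = (x.1, 1, x.2) :=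
    ⟨⟨fun x => (x.1, 1, x.2), fun x y h => by simpa [Prod.ext_iff] using h⟩, fun _ => rfl⟩
  have ho := orthonormal_sqrt_two_smul_cubeTrig 𝕜 d
  have hS : Orthonormal 𝕜 fun i : Finset.univ.map f =>
      ((√2 : ℝ) : 𝕜) • (memLp_cubeTrig 𝕜 d i).toLp _ := by
    have h1 : ∀ i : Finset.univ.map f, ((i.1.1, 1, i.1.2.2) : Fin d × ℕ × Bool) = i.1 := by
      rintro ⟨i, hi⟩
      obtain ⟨x, -, rfl⟩ := Finset.mem_map.1 hi
      simp [hf]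
    have h2 := ho.comp (fun i : Finset.univ.map f => (i.1.1, i.1.2.2)) fun i i' h => by
      simp only [Prod.mk.injEq] at h
      rw [Subtype.ext_iff, ← h1 i, ← h1 i', h.1, h.2]
    convert h2 using 1
    funext i
    exact congrArg (fun x => ((√2 : ℝ) : 𝕜) • (memLp_cubeTrig 𝕜 d x).toLp _) (h1 i).symm
  have h := hY.le_lintegral_sub_rankApprox (fun t => additiveKorobovCov_self d t)
    (summable_korobovWeight hα hβ hσ d) (korobovWeight_nonneg hα hβ d) (memLp_cubeTrig 𝕜 d)
    (fun i t => abs_trigFun_le_one _ _ _) (hasSum_korobovWeight_mul hα hβ hσ d) _ hS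
    (mul_nonneg two_pos.le hθ) ψ
  refine le_of_eq_of_le (congrArg _ ?_) h
  rw [Finset.sum_map, Fintype.sum_prod_type, Finset.sum_range]
  have hmin : ∀ j : Fin d, min (2 * β (j + 1)) (2 * θ) = 2 * min (β (j + 1)) θ := fun j =>
    (mul_min_of_nonneg _ _ two_pos.le).symm
  simp only [hf, korobovWeight, one_ne_zero, if_false, Nat.cast_one, Real.one_rpow, mul_one, hmin,
    Fintype.sum_bool, ← two_mul, ← Finset.mul_sum]
  ring

/-- The constant function captures at least all the `α` at once, and each of the two frequency-one
functions of a coordinate captures at least its `β`. The single extra function is asymptotically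
harmless. -/
theorem korobov_averageError_upper (A : Finset (Fin d)) :
    averageError P Y (2 * A.card + 1) ≤ ENNReal.ofReal
      (∑ j ∈ Finset.range d, (korobovTrace (α (j + 1)) (β (j + 1)) (σ (j + 1)) - α (j + 1)) -
        2 * ∑ j ∈ A, β (j + 1)) ^ (1 / 2 : ℝ) := by
  have ho := orthonormal_option_cubeTrig 𝕜 d
  set e : Option (A × Bool) → Lp 𝕜 2 (volume : Measure (Cube d)) := fun x =>
    (x.map fun x => ((x.1 : Fin d), x.2)).elim
      ((memLp_const (1 : 𝕜)).toLp _ : Lp 𝕜 2 (volume : Measure (Cube d))) fun x =>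
        ((√2 : ℝ) : 𝕜) • (memLp_cubeTrig 𝕜 d (x.1, 1, x.2)).toLp _ with he
  have heo : Orthonormal 𝕜 e := ho.comp (Option.map fun x : A × Bool => ((x.1 : Fin d), x.2)) <|
    Option.map_injective fun x y h => by
      simp only [Prod.mk.injEq] at h
      exact Prod.ext (Subtype.ext h.1) h.2
  have hw0 := korobovWeight_nonneg (σ := σ) hα hβ d
  have hq := fun v => hY.hasSum_integral_norm_sq_integral (fun t => additiveKorobovCov_self d t)
    (summable_korobovWeight hα hβ hσ d) hw0 (memLp_cubeTrig 𝕜 d)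
    (fun i t => abs_trigFun_le_one _ _ _) (hasSum_korobovWeight_mul hα hβ hσ d) v
  have h := hY.averageError_card_le (fun t => additiveKorobovCov_self d t) heo
    (lam := fun x => x.elim (∑ j ∈ Finset.range d, α (j + 1)) fun x => β ((x.1 : Fin d) + 1)) ?_
  · refine le_of_eq_of_le (congrArg _ ?_) (h.trans_eq (congrArg (ENNReal.ofReal · ^ (1 / 2 : ℝ)) ?_))
    · simp [mul_comm]
    · rw [Fintype.sum_option, Fintype.sum_prod_type, Finset.sum_sub_distrib]
      simp only [Option.elim, Fintype.sum_bool, Finset.sum_add_distrib]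
      rw [Finset.sum_coe_sort A fun j : Fin d => β (j + 1)]
      ring
  · rintro (_ | ⟨j, b⟩)
    · obtain ⟨f, hf⟩ : ∃ f : Fin d ↪ Fin d × ℕ × Bool, ∀ x, f x = (x, 0, true) :=
        ⟨⟨fun x => (x, 0, true), fun x y h => by simpa [Prod.ext_iff] using h⟩, fun _ => rfl⟩
      have h1 := sum_le_hasSum (Finset.univ.map f)
        (fun i _ => mul_nonneg (hw0 i) (by positivity)) (hq (e none))
      refine le_of_eq_of_le ?_ h1
      rw [Finset.sum_map, Finset.sum_range]
      refine Finset.sum_congr rfl fun j _ => ?_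
      -- The frequency-zero cosines of all `d` coordinates are the same function, so one direction
      -- collects every `α`.
      have h2 : ∀ i : Fin d, (memLp_cubeTrig 𝕜 d (i, 0, true)).toLp _ = e none := fun i => by
        simp [he, cubeTrig, trigFun]
      simp only [hf, h2]
      rw [inner_self_eq_norm_sq_to_K, heo.1]
      simp [korobovWeight]
    -- One term of the series is enough: weight `2 β` times `(√2 · 1/2)² = 1/2` gives `β`.
    · have h1 := le_hasSum (hq (e (some (j, b)))) ((j : Fin d), 1, b)
        fun i _ => mul_nonneg (hw0 i) (by positivity)
      refine le_of_eq_of_le ?_ h1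
      simp only [he, Option.map_some, Option.elim, inner_smul_left, inner_toLp_ofReal,
        integral_cubeTrig_one_mul]
      simp [korobovWeight, mul_pow]
      ring

theorem korobov_le_of_averageError_le {ε : ℝ} (hε : 0 < ε) {θ : ℝ} (hθ : 0 ≤ θ) {n : ℕ}
    (hn : averageError P Y n ≤ ENNReal.ofReal ε * averageError P Y 0) :
    2 * ∑ j ∈ Finset.range d, min (β (j + 1)) θ - θ * n ≤
      ε ^ 2 * ∑ j ∈ Finset.range d, korobovTrace (α (j + 1)) (β (j + 1)) (σ (j + 1)) := by
  have h := (korobov_averageError_lower hα hβ hσ hY hθ n).trans hn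
  rw [hY.averageError_zero (fun t => additiveKorobovCov_self d t),
    ENNReal.ofReal_mul_ofReal_rpow_half hε.le, ENNReal.rpow_le_rpow_iff (by norm_num)] at h
  exact (ENNReal.ofReal_le_ofReal_iff (mul_nonneg (sq_nonneg _) (Finset.sum_nonneg fun j _ =>
    (korobovTrace_pos (hα _ (by omega)) (hβ _ (by omega)).le).le))).1 h

theorem korobov_averageError_le_of_le {ε : ℝ} (hε : 0 < ε) (A : Finset (Fin d))
    (hA : ∑ j ∈ Finset.range d, (korobovTrace (α (j + 1)) (β (j + 1)) (σ (j + 1)) - α (j + 1)) -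
        2 * ∑ j ∈ A, β (j + 1) ≤
      ε ^ 2 * ∑ j ∈ Finset.range d, korobovTrace (α (j + 1)) (β (j + 1)) (σ (j + 1))) :
    averageError P Y (2 * A.card + 1) ≤ ENNReal.ofReal ε * averageError P Y 0 := by
  refine (korobov_averageError_upper hα hβ hσ hY A).trans ?_
  rw [hY.averageError_zero (fun t => additiveKorobovCov_self d t),
    ENNReal.ofReal_mul_ofReal_rpow_half hε.le]
  exact ENNReal.rpow_le_rpow (ENNReal.ofReal_le_ofReal hA) (by norm_num)

end Complexity

/-! ### Sums of regularly varying sequences -/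

/-- After division by `(j + 1)^b` this is the difference quotient of `x ^ b` at `1`, taken at the
point `1 - 1/(j + 1)`. -/
theorem tendsto_rpow_sub_rpow_div {b : ℝ} :
    Tendsto (fun j : ℕ => (((j : ℝ) + 1) ^ b - (j : ℝ) ^ b) / ((j : ℝ) + 1) ^ (b - 1)) atTop
      (𝓝 b) := by
  have h1 : HasDerivAt (fun x : ℝ => x ^ b) b 1 := by
    simpa using Real.hasDerivAt_rpow_const (x := 1) (p := b) (Or.inl one_ne_zero)
  have h2 : Tendsto (fun j : ℕ => 1 - 1 / ((j : ℝ) + 1)) atTop (𝓝[≠] 1) := by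
    refine tendsto_nhdsWithin_iff.2 ⟨?_, .of_forall fun j => ?_⟩
    · simpa using tendsto_one_div_add_atTop_nhds_zero_nat.const_sub (1 : ℝ)
    · have : (1 : ℝ) / ((j : ℝ) + 1) ≠ 0 := by positivity
      simpa using this
  refine ((hasDerivAt_iff_tendsto_slope.1 h1).comp h2).congr fun j => ?_
  have hj : (0 : ℝ) < (j : ℝ) + 1 := by positivity
  have h3 : 1 - 1 / ((j : ℝ) + 1) = j / ((j : ℝ) + 1) := by field_simp; ring
  simp only [Function.comp_apply, slope_def_field, Real.one_rpow]
  rw [h3, Real.div_rpow (by positivity) hj.le, Real.rpow_sub_one hj.ne', ← h3]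
  have : ((j : ℝ) + 1) ^ b ≠ 0 := (Real.rpow_pos_of_pos hj b).ne'
  field_simp
  ring

/-- A Stolz–Cesàro argument: `f` is compared with the increments of `j^{1-τ}`, which telescope.
Since `τ < 1` their sums diverge, so a termwise little-o survives summation. -/
theorem tendsto_sum_div_rpow {f : ℕ → ℝ} {τ l : ℝ} (hτ : τ < 1)
    (hf : Tendsto (fun j : ℕ => f j / ((j : ℝ) + 1) ^ (-τ)) atTop (𝓝 l)) :
    Tendsto (fun n : ℕ => (∑ j ∈ Finset.range n, f j) / (n : ℝ) ^ (1 - τ)) atTop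
      (𝓝 (l / (1 - τ))) := by
  have hb : 0 < 1 - τ := sub_pos.2 hτ
  set u : ℕ → ℝ := fun j => ((j : ℝ) + 1) ^ (1 - τ) - (j : ℝ) ^ (1 - τ) with hu
  have hu0 : ∀ j, 0 < u j := fun j =>
    sub_pos.2 (Real.rpow_lt_rpow (by positivity) (by linarith) hb)
  have hsum : ∀ n, ∑ j ∈ Finset.range n, u j = (n : ℝ) ^ (1 - τ) := fun n => by
    have := Finset.sum_range_sub (fun j : ℕ => (j : ℝ) ^ (1 - τ)) n
    simpa [hu, Real.zero_rpow hb.ne'] using this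
  have h1 : Tendsto (fun j => f j / u j) atTop (𝓝 (l / (1 - τ))) := by
    have h2 := tendsto_rpow_sub_rpow_div (b := 1 - τ)
    rw [show 1 - τ - 1 = -τ by ring] at h2
    refine (hf.div h2 hb.ne').congr fun j => ?_
    have : ((j : ℝ) + 1) ^ (-τ) ≠ 0 := (Real.rpow_pos_of_pos (by positivity) _).ne'
    have := (hu0 j).ne'
    simp only [Pi.div_apply]
    rw [show ((j : ℝ) + 1) ^ (1 - τ) - (j : ℝ) ^ (1 - τ) = u j from rfl]
    field_simp
  have h2 : (fun j => f j - l / (1 - τ) * u j) =o[atTop] u := by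
    rw [Asymptotics.isLittleO_iff_tendsto fun j hj => absurd hj (hu0 j).ne']
    have h3 := h1.sub_const (l / (1 - τ))
    rw [sub_self] at h3
    refine h3.congr fun j => ?_
    have := (hu0 j).ne'
    field_simp
  have htop : Tendsto (fun n : ℕ => ∑ j ∈ Finset.range n, u j) atTop atTop := by
    simp only [hsum]
    exact (tendsto_rpow_atTop hb).comp tendsto_natCast_atTop_atTop
  have h4 := (h2.sum_range (fun j => (hu0 j).le) htop).tendsto_div_nhds_zero
  simp only [Finset.sum_sub_distrib, ← Finset.mul_sum, hsum] at h4
  have h5 := h4.add_const (l / (1 - τ))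
  rw [zero_add] at h5
  refine h5.congr' ?_
  filter_upwards [eventually_gt_atTop 0] with n hn
  have : (n : ℝ) ^ (1 - τ) ≠ 0 := (Real.rpow_pos_of_pos (by exact_mod_cast hn) _).ne'
  field_simp
  ring

theorem tendsto_floor_mul_div_nat {x : ℝ} (hx : 0 ≤ x) :
    Tendsto (fun n : ℕ => (⌊x * n⌋₊ : ℝ) / n) atTop (𝓝 x) :=
  (tendsto_nat_floor_mul_div_atTop hx).comp tendsto_natCast_atTop_atTop

theorem tendsto_floor_mul_nat_atTop {x : ℝ} (hx : 0 < x) :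
    Tendsto (fun n : ℕ => ⌊x * n⌋₊) atTop atTop :=
  tendsto_nat_floor_atTop.comp (tendsto_natCast_atTop_atTop.const_mul_atTop hx)

theorem tendsto_sum_floor_div_rpow {f : ℕ → ℝ} {τ l x : ℝ} (hτ : τ < 1) (hx : 0 < x)
    (hf : Tendsto (fun j : ℕ => f j / ((j : ℝ) + 1) ^ (-τ)) atTop (𝓝 l)) :
    Tendsto (fun n : ℕ => (∑ j ∈ Finset.range ⌊x * n⌋₊, f j) / (n : ℝ) ^ (1 - τ)) atTop
      (𝓝 (l / (1 - τ) * x ^ (1 - τ))) := by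
  have h1 := (tendsto_sum_div_rpow hτ hf).comp (tendsto_floor_mul_nat_atTop hx)
  have h2 := (tendsto_floor_mul_div_nat hx.le).rpow_const (p := 1 - τ) (Or.inl hx.ne')
  refine (h1.mul h2).congr' ?_
  filter_upwards [(tendsto_floor_mul_nat_atTop hx).eventually_gt_atTop 0] with n hn
  have : ((⌊x * n⌋₊ : ℕ) : ℝ) ^ (1 - τ) ≠ 0 :=
    (Real.rpow_pos_of_pos (by exact_mod_cast hn) _).ne'
  simp only [Function.comp_apply]
  rw [Real.div_rpow (by positivity) (by positivity)]
  field_simp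

/-- The sums of the reciprocal powers tend to `1` as the exponent tends to infinity. -/
theorem tendsto_tsum_nat_add_one_rpow_neg :
    Tendsto (fun s : ℝ => ∑' k : ℕ, ((k + 1 : ℕ) : ℝ) ^ (-s)) atTop (𝓝 1) := by
  have h : (1 : ℝ) = ∑' k : ℕ, if k = 0 then (1 : ℝ) else 0 := by simp
  rw [h]
  -- Exponent `2` dominates all larger exponents, and every term except the first tends to zero.
  refine tendsto_tsum_of_dominated_convergence
    (summable_nat_add_one_rpow_neg (s := 2) (by norm_num)) (fun k => ?_) ?_
  · rcases eq_or_ne k 0 with rfl | hk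
    · simp
    · rw [if_neg hk]
      have : (1 : ℝ) < ((k + 1 : ℕ) : ℝ) := by
        exact_mod_cast Nat.lt_add_of_pos_left (Nat.pos_of_ne_zero hk)
      exact (tendsto_rpow_atBot_of_base_gt_one _ this).comp tendsto_neg_atTop_atBot
  · filter_upwards [eventually_ge_atTop 2] with s hs k
    rw [Real.norm_of_nonneg (by positivity)]
    exact Real.rpow_le_rpow_of_exponent_le (by simp) (neg_le_neg hs)

/-! ### Lower bound for the number of functions by duality -/

section Threshold

variable {β' T : ℕ → ℝ} {c τ r ε x : ℝ} (hc : 0 < c) (hτ : τ < 1)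
  (hβ : Tendsto (fun j : ℕ => β' j / ((j : ℝ) + 1) ^ (-τ)) atTop (𝓝 c))
  (hT : Tendsto (fun j : ℕ => T j / ((j : ℝ) + 1) ^ (-τ)) atTop (𝓝 ((r + 2) * c)))

include hβ in
theorem tendsto_abs_sub_div :
    Tendsto (fun j : ℕ => |β' j - c * ((j : ℝ) + 1) ^ (-τ)| / ((j : ℝ) + 1) ^ (-τ)) atTop (𝓝 0) := by
  have h := (hβ.sub_const c).abs
  rw [sub_self, abs_zero] at h
  refine h.congr fun j => ?_
  have : (0 : ℝ) < ((j : ℝ) + 1) ^ (-τ) := Real.rpow_pos_of_pos (by positivity) _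
  rw [← abs_of_pos this, ← abs_div, abs_of_pos this]
  field_simp

theorem tendsto_const_mul_rpow_div (c τ : ℝ) :
    Tendsto (fun j : ℕ => c * ((j : ℝ) + 1) ^ (-τ) / ((j : ℝ) + 1) ^ (-τ)) atTop (𝓝 c) := by
  refine tendsto_const_nhds.congr fun j => ?_
  rw [mul_div_cancel_right₀ _ (Real.rpow_pos_of_pos (by positivity) _).ne']

include hc hτ hβ hT in
/-- The dual lower bound on the number of terms, given an asymptotic lower bound `M` for the
truncated sums of the pure powers. -/
theorem eventually_lt_div_of_dual (hx : 0 < x) {M : ℕ → ℝ} {μ q : ℝ}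
    (hM : Tendsto (fun d : ℕ => M d / (d : ℝ) ^ (1 - τ)) atTop (𝓝 μ))
    (hMle : ∀ᶠ d : ℕ in atTop, M d ≤ ∑ j ∈ Finset.range d,
      min (c * ((j : ℝ) + 1) ^ (-τ)) (c * (⌊x * d⌋₊ : ℝ) ^ (-τ)))
    (hq : (2 * μ - ε ^ 2 * ((r + 2) * c / (1 - τ))) / (c * x ^ (-τ)) = q)
    {N : ℕ → ℕ} (hN : ∀ᶠ d : ℕ in atTop, ∀ θ : ℝ, 0 ≤ θ →
      2 * ∑ j ∈ Finset.range d, min (β' j) θ - θ * N d ≤ ε ^ 2 * ∑ j ∈ Finset.range d, T j)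
    {a : ℝ} (ha : a < q) : ∀ᶠ d : ℕ in atTop, a < (N d : ℝ) / d := by
  have h1 := tendsto_sum_div_rpow hτ (tendsto_abs_sub_div hβ)
  have h2 := tendsto_sum_div_rpow hτ hT
  have h3 := (tendsto_floor_mul_div_nat hx.le).rpow_const (p := -τ) (Or.inl hx.ne')
  have h4 := ((((hM.sub h1).const_mul 2).sub (h2.const_mul (ε ^ 2))).div (h3.const_mul c)
    (by positivity))
  rw [zero_div, sub_zero, hq] at h4
  filter_upwards [h4.eventually (lt_mem_nhds ha), hMle, hN, eventually_gt_atTop 0,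
    (tendsto_floor_mul_nat_atTop hx).eventually_gt_atTop 0] with d hd hMd hNd hd0 hm
  refine hd.trans_le ?_
  have hd0' : (0 : ℝ) < d := by exact_mod_cast hd0
  have hm' : (0 : ℝ) < (⌊x * d⌋₊ : ℝ) := by exact_mod_cast hm
  -- The multiplier is the power weight at the cut, where selected and rejected coordinates meet.
  set θ := c * (⌊x * d⌋₊ : ℝ) ^ (-τ) with hθ
  have hθ0 : 0 < θ := by positivity
  have h5 := hNd θ hθ0.le
  -- Truncation `min(·, θ)` is 1-Lipschitz, so passing from the pure powers to `β'` costs at most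
  -- the sum of the deviations, which is `o(d^{1-τ})`.
  have h6 : M d - ∑ j ∈ Finset.range d, |β' j - c * ((j : ℝ) + 1) ^ (-τ)| ≤
      ∑ j ∈ Finset.range d, min (β' j) θ := by
    refine (sub_le_sub_right hMd _).trans ?_
    rw [← Finset.sum_sub_distrib]
    refine Finset.sum_le_sum fun j _ => ?_
    rw [sub_le_iff_le_add, min_def (β' j)]
    split_ifs
    · have h7 := neg_abs_le (β' j - c * ((j : ℝ) + 1) ^ (-τ))
      have h8 := min_le_left (c * ((j : ℝ) + 1) ^ (-τ)) θ
      linarith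
    · have h7 := abs_nonneg (β' j - c * ((j : ℝ) + 1) ^ (-τ))
      have h8 := min_le_right (c * ((j : ℝ) + 1) ^ (-τ)) θ
      linarith
  have hdb : (0 : ℝ) < (d : ℝ) ^ (1 - τ) := by positivity
  have h9 : (c * ((⌊x * d⌋₊ : ℝ) / d) ^ (-τ)) * (d : ℝ) ^ (1 - τ) = θ * d := by
    rw [Real.div_rpow hm'.le hd0'.le, sub_eq_add_neg, Real.rpow_add hd0', Real.rpow_one, hθ]
    have : (d : ℝ) ^ (-τ) ≠ 0 := by positivity
    field_simp
  have h10 : 0 < c * ((⌊x * d⌋₊ : ℝ) / d) ^ (-τ) := by positivity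
  simp only [Pi.div_apply]
  rw [div_le_div_iff₀ h10 hd0', ← mul_le_mul_iff_left₀ hdb]
  have h11 : ∀ A B D : ℝ, (2 * (A / (d : ℝ) ^ (1 - τ) - B / (d : ℝ) ^ (1 - τ)) -
      ε ^ 2 * (D / (d : ℝ) ^ (1 - τ))) * d * (d : ℝ) ^ (1 - τ) =
      (2 * (A - B) - ε ^ 2 * D) * d := fun A B D => by field_simp
  rw [h11, mul_assoc, h9, ← mul_assoc]
  refine mul_le_mul_of_nonneg_right ?_ hd0'.le
  linarith

include hc hτ hβ hT in
-- For `τ ≥ 0` the powers do not increase, so exactly the initial block up to the cut is replaced by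
-- the threshold value and the tail is kept. The equation for `x` makes the tail balance the allowed
-- error.
theorem eventually_lt_div_of_dual_of_nonneg (hτ0 : 0 ≤ τ) (hx : 0 < x) (hx1 : x < 1)
    (hxE : x ^ (1 - τ) = 1 - ε ^ 2 * (1 + r / 2))
    {N : ℕ → ℕ} (hN : ∀ᶠ d : ℕ in atTop, ∀ θ : ℝ, 0 ≤ θ →
      2 * ∑ j ∈ Finset.range d, min (β' j) θ - θ * N d ≤ ε ^ 2 * ∑ j ∈ Finset.range d, T j)
    {a : ℝ} (ha : a < 2 * x) : ∀ᶠ d : ℕ in atTop, a < (N d : ℝ) / d := by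
  have h1 := tendsto_sum_div_rpow hτ (tendsto_const_mul_rpow_div c τ)
  have h2 := tendsto_sum_floor_div_rpow hτ hx (tendsto_const_mul_rpow_div c τ)
  have h3 := ((tendsto_floor_mul_div_nat hx.le).rpow_const (p := 1 - τ) (Or.inl hx.ne')).const_mul c
  refine eventually_lt_div_of_dual hc hτ hβ hT hx
    (M := fun d => c * (⌊x * d⌋₊ : ℝ) ^ (1 - τ) + (∑ j ∈ Finset.range d, c * ((j : ℝ) + 1) ^ (-τ) -
      ∑ j ∈ Finset.range ⌊x * d⌋₊, c * ((j : ℝ) + 1) ^ (-τ)))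
    ((h3.add (h1.sub h2)).congr fun d => ?_) ?_ ?_ hN ha
  · rw [Real.div_rpow (by positivity) (by positivity)]
    ring
  · filter_upwards [(tendsto_floor_mul_nat_atTop hx).eventually_gt_atTop 0] with d hm
    have hmd : ⌊x * d⌋₊ ≤ d := Nat.floor_le_of_le (by nlinarith [Nat.cast_nonneg (α := ℝ) d])
    have hm' : (0 : ℝ) < (⌊x * d⌋₊ : ℝ) := by exact_mod_cast hm
    rw [← Finset.sum_range_add_sum_Ico _ hmd, ← Finset.sum_range_add_sum_Ico _ hmd,
      add_sub_cancel_left]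
    refine add_le_add (le_of_eq ?_) (Finset.sum_le_sum fun j hj => ?_)
    · rw [Finset.sum_congr rfl fun j hj => min_eq_right ?_]
      · rw [Finset.sum_const, Finset.card_range, nsmul_eq_mul, sub_eq_add_neg,
          Real.rpow_add hm', Real.rpow_one]
        ring
      · have hj' : (j : ℝ) + 1 ≤ (⌊x * d⌋₊ : ℝ) := by exact_mod_cast Finset.mem_range.1 hj
        exact mul_le_mul_of_nonneg_left
          (Real.rpow_le_rpow_of_nonpos (by positivity) hj' (by linarith)) hc.le
    · have hj' : (⌊x * d⌋₊ : ℝ) ≤ (j : ℝ) + 1 := by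
        exact_mod_cast ((Finset.mem_Ico.1 hj).1.trans (Nat.le_succ j))
      exact le_min le_rfl (mul_le_mul_of_nonneg_left
          (Real.rpow_le_rpow_of_nonpos hm' hj' (by linarith)) hc.le)
  · have hb : 1 - τ ≠ 0 := (sub_pos.2 hτ).ne'
    have h4 : x ^ (1 - τ) = x * x ^ (-τ) := by
      rw [sub_eq_add_neg, Real.rpow_add hx, Real.rpow_one]
    have h5 : 0 < x ^ (-τ) := by positivity
    have h6 : ε ^ 2 * ((r + 2) * c / (1 - τ)) = 2 * (c / (1 - τ)) * (1 - x ^ (1 - τ)) := by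
      rw [hxE]
      ring
    rw [h6, div_eq_iff (by positivity), h4]
    ring

include hc hτ hβ hT in
-- For `τ < 0` the powers increase and the roles are exchanged: the initial block is kept, the final
-- block is capped, and the kept part balances the allowed error.
theorem eventually_lt_div_of_dual_of_neg (hτ0 : τ < 0) (hx : 0 < x) (hx1 : x < 1)
    (hxE : x ^ (1 - τ) = ε ^ 2 * (1 + r / 2))
    {N : ℕ → ℕ} (hN : ∀ᶠ d : ℕ in atTop, ∀ θ : ℝ, 0 ≤ θ →
      2 * ∑ j ∈ Finset.range d, min (β' j) θ - θ * N d ≤ ε ^ 2 * ∑ j ∈ Finset.range d, T j)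
    {a : ℝ} (ha : a < 2 * (1 - x)) : ∀ᶠ d : ℕ in atTop, a < (N d : ℝ) / d := by
  have h2 := tendsto_sum_floor_div_rpow hτ hx (tendsto_const_mul_rpow_div c τ)
  have h3 := (((tendsto_floor_mul_div_nat hx.le).const_sub 1).mul
    ((tendsto_floor_mul_div_nat hx.le).rpow_const (p := -τ) (Or.inl hx.ne'))).const_mul c
  refine eventually_lt_div_of_dual hc hτ hβ hT hx
    (M := fun d => ∑ j ∈ Finset.range ⌊x * d⌋₊, c * ((j : ℝ) + 1) ^ (-τ) +
      ((d : ℝ) - ⌊x * d⌋₊) * (c * (⌊x * d⌋₊ : ℝ) ^ (-τ)))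
    ((h2.add h3).congr' ?_) ?_ ?_ hN ha
  · filter_upwards [eventually_gt_atTop 0] with d hd
    have hd' : (0 : ℝ) < d := by exact_mod_cast hd
    rw [Real.div_rpow (by positivity) (by positivity), sub_eq_add_neg 1 τ, Real.rpow_add hd',
      Real.rpow_one]
    have : (d : ℝ) ^ (-τ) ≠ 0 := by positivity
    field_simp
  · filter_upwards [(tendsto_floor_mul_nat_atTop hx).eventually_gt_atTop 0] with d hm
    have hmd : ⌊x * d⌋₊ ≤ d := Nat.floor_le_of_le (by nlinarith [Nat.cast_nonneg (α := ℝ) d])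
    rw [← Finset.sum_range_add_sum_Ico _ hmd]
    refine add_le_add (Finset.sum_le_sum fun j hj => ?_) (le_of_eq ?_)
    · have hj' : (j : ℝ) + 1 ≤ (⌊x * d⌋₊ : ℝ) := by exact_mod_cast Finset.mem_range.1 hj
      exact le_min le_rfl (mul_le_mul_of_nonneg_left
          (Real.rpow_le_rpow (by positivity) hj' (by linarith)) hc.le)
    · rw [Finset.sum_congr rfl fun j hj => min_eq_right ?_]
      · rw [Finset.sum_const, Nat.card_Ico, nsmul_eq_mul, Nat.cast_sub hmd]
      · have hj' : (⌊x * d⌋₊ : ℝ) ≤ (j : ℝ) + 1 := by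
          exact_mod_cast ((Finset.mem_Ico.1 hj).1.trans (Nat.le_succ j))
        exact mul_le_mul_of_nonneg_left
          (Real.rpow_le_rpow (by positivity) hj' (by linarith)) hc.le
  · have h5 : 0 < x ^ (-τ) := by positivity
    have h6 : ε ^ 2 * ((r + 2) * c / (1 - τ)) = 2 * (c / (1 - τ)) * x ^ (1 - τ) := by
      rw [hxE]
      ring
    rw [h6, div_eq_iff (by positivity)]
    ring

end Threshold

/-! ### Choice of coordinates for the upper bound -/

section Selection

variable {β' T R : ℕ → ℝ} {c τ r ε x : ℝ} (hc : 0 < c) (hτ : τ < 1)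
  (hβ : Tendsto (fun j : ℕ => β' j / ((j : ℝ) + 1) ^ (-τ)) atTop (𝓝 c))
  (hT : Tendsto (fun j : ℕ => T j / ((j : ℝ) + 1) ^ (-τ)) atTop (𝓝 ((r + 2) * c)))
  (hR : Tendsto (fun j : ℕ => R j / ((j : ℝ) + 1) ^ (-τ)) atTop (𝓝 (2 * c)))

include hc hτ hβ hT hR

theorem exists_finset_of_nonneg (hx : 0 < x) (hx1 : x < 1)
    (hxE : x ^ (1 - τ) = 1 - ε ^ 2 * (1 + r / 2)) {a : ℝ} (ha : 2 * x < a) :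
    ∀ᶠ d : ℕ in atTop, ∃ A ⊆ Finset.range d,
      ∑ j ∈ Finset.range d, R j - 2 * ∑ j ∈ A, β' j ≤ ε ^ 2 * ∑ j ∈ Finset.range d, T j ∧
      ((2 * A.card + 1 : ℕ) : ℝ) / d < a := by
  have hb : 0 < 1 - τ := sub_pos.2 hτ
  -- A block slightly longer than the critical one makes the limiting error inequality strict. The
  -- slack absorbs the lower order terms, while `y < a / 2` leaves room for the extra constant
  -- function.
  obtain ⟨y, hxy, hy⟩ := exists_between (lt_min hx1 (show x < a / 2 by linarith))
  have hy0 : 0 < y := hx.trans hxy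
  have hya : 2 * y + 0 < a := by linarith [hy.trans_le (min_le_right _ _)]
  have h1 := (tendsto_sum_div_rpow hτ hR).sub ((tendsto_sum_floor_div_rpow hτ hy0 hβ).const_mul 2)
  have h2 := (tendsto_sum_div_rpow hτ hT).const_mul (ε ^ 2)
  have h3 := ((tendsto_floor_mul_div_nat hy0.le).const_mul 2).add tendsto_one_div_atTop_nhds_zero_nat
  have hlt : 2 * c / (1 - τ) - 2 * (c / (1 - τ) * y ^ (1 - τ)) <
      ε ^ 2 * ((r + 2) * c / (1 - τ)) := by
    have h4 : ε ^ 2 * ((r + 2) * c / (1 - τ)) = 2 * (c / (1 - τ)) * (1 - x ^ (1 - τ)) := by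
      rw [hxE]
      ring
    have h5 := mul_lt_mul_of_pos_left (Real.rpow_lt_rpow hx.le hxy hb) (div_pos hc hb)
    rw [h4, mul_div_assoc]
    linarith
  filter_upwards [h1.eventually_lt h2 hlt, h3.eventually (gt_mem_nhds hya),
    eventually_gt_atTop 0] with d hd1 hd2 hd0
  have hd' : (0 : ℝ) < d := by exact_mod_cast hd0
  have hdb : (0 : ℝ) < (d : ℝ) ^ (1 - τ) := by positivity
  refine ⟨Finset.range ⌊y * d⌋₊, Finset.range_subset_range.2 (Nat.floor_le_of_le ?_), ?_, ?_⟩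
  · nlinarith [hy.trans_le (min_le_left _ _)]
  · have h6 := mul_lt_mul_of_pos_right hd1 hdb
    have h7 : ∀ A B : ℝ, (A / (d : ℝ) ^ (1 - τ) - 2 * (B / (d : ℝ) ^ (1 - τ))) * (d : ℝ) ^ (1 - τ) =
      A - 2 * B := fun A B => by field_simp
    rw [h7, mul_assoc, div_mul_cancel₀ _ hdb.ne'] at h6
    exact h6.le
  · refine lt_of_eq_of_lt ?_ hd2
    rw [Finset.card_range]
    push_cast
    ring

theorem exists_finset_of_neg (hx : 0 < x) (hx1 : x < 1)
    (hxE : x ^ (1 - τ) = ε ^ 2 * (1 + r / 2)) {a : ℝ} (ha : 2 * (1 - x) < a) :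
    ∀ᶠ d : ℕ in atTop, ∃ A ⊆ Finset.range d,
      ∑ j ∈ Finset.range d, R j - 2 * ∑ j ∈ A, β' j ≤ ε ^ 2 * ∑ j ∈ Finset.range d, T j ∧
      ((2 * A.card + 1 : ℕ) : ℝ) / d < a := by
  have hb : 0 < 1 - τ := sub_pos.2 hτ
  -- Here the final block from `y d` on is selected, so enlarging it means cutting slightly before
  -- `x`.
  obtain ⟨y, hy, hyx⟩ := exists_between (max_lt hx (show 1 - a / 2 < x by linarith))
  have hy0 : 0 < y := (le_max_left _ _).trans_lt hy
  have hya : 2 * (1 - y) + 0 < a := by linarith [(le_max_right _ _).trans_lt hy]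
  have h1 := (tendsto_sum_div_rpow hτ hR).sub
    (((tendsto_sum_div_rpow hτ hβ).sub (tendsto_sum_floor_div_rpow hτ hy0 hβ)).const_mul 2)
  have h2 := (tendsto_sum_div_rpow hτ hT).const_mul (ε ^ 2)
  have h3 := (((tendsto_floor_mul_div_nat hy0.le).const_sub 1).const_mul 2).add
    tendsto_one_div_atTop_nhds_zero_nat
  have hlt : 2 * c / (1 - τ) - 2 * (c / (1 - τ) - c / (1 - τ) * y ^ (1 - τ)) <
      ε ^ 2 * ((r + 2) * c / (1 - τ)) := by
    have h4 : ε ^ 2 * ((r + 2) * c / (1 - τ)) = 2 * (c / (1 - τ)) * x ^ (1 - τ) := by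
      rw [hxE]
      ring
    have h5 := mul_lt_mul_of_pos_left (Real.rpow_lt_rpow hy0.le hyx hb) (div_pos hc hb)
    rw [h4, mul_div_assoc]
    linarith
  filter_upwards [h1.eventually_lt h2 hlt, h3.eventually (gt_mem_nhds hya),
    eventually_gt_atTop 0] with d hd1 hd2 hd0
  have hd' : (0 : ℝ) < d := by exact_mod_cast hd0
  have hdb : (0 : ℝ) < (d : ℝ) ^ (1 - τ) := by positivity
  have hmd : ⌊y * d⌋₊ ≤ d := Nat.floor_le_of_le (by nlinarith)
  refine ⟨Finset.Ico ⌊y * d⌋₊ d, fun j hj => Finset.mem_range.2 (Finset.mem_Ico.1 hj).2, ?_, ?_⟩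
  · have h6 := mul_lt_mul_of_pos_right hd1 hdb
    have h7 : ∀ A B D : ℝ, (A / (d : ℝ) ^ (1 - τ) - 2 * (B / (d : ℝ) ^ (1 - τ) -
      D / (d : ℝ) ^ (1 - τ))) * (d : ℝ) ^ (1 - τ) = A - 2 * (B - D) := fun A B D => by field_simp
    rw [h7, mul_assoc, div_mul_cancel₀ _ hdb.ne'] at h6
    rw [Finset.sum_Ico_eq_sub _ hmd]
    exact h6.le
  · refine lt_of_eq_of_lt ?_ hd2
    rw [Nat.card_Ico]
    push_cast [Nat.cast_sub hmd]
    field_simp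

end Selection

/-! ### Error bound for coordinate sets given as subsets of an initial segment -/

section Complexity

variable {𝕜 : Type*} [RCLike 𝕜] {α β σ : ℕ → ℝ} (hα : ∀ j, 1 ≤ j → 0 < α j)
  (hβ : ∀ j, 1 ≤ j → 0 < β j) (hσ : ∀ j, 1 ≤ j → 1 < σ j)
  {Ω : Type*} [MeasurableSpace Ω] {P : Measure Ω} [IsProbabilityMeasure P] {d : ℕ}
  {Y : Cube d → Ω → 𝕜} (hY : IsCenteredField P Y (additiveKorobovCov α β σ d))

include hα hβ hσ hY

theorem korobov_averageError_le_of_subset_range {ε : ℝ} (hε : 0 < ε) {A : Finset ℕ}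
    (hAd : A ⊆ Finset.range d)
    (hA : ∑ j ∈ Finset.range d, (korobovTrace (α (j + 1)) (β (j + 1)) (σ (j + 1)) - α (j + 1)) -
        2 * ∑ j ∈ A, β (j + 1) ≤
      ε ^ 2 * ∑ j ∈ Finset.range d, korobovTrace (α (j + 1)) (β (j + 1)) (σ (j + 1))) :
    averageError P Y (2 * A.card + 1) ≤ ENNReal.ofReal ε * averageError P Y 0 := by
  have h1 : ∀ j ∈ A, j < d := fun j hj => Finset.mem_range.1 (hAd hj)
  have h2 : (A.attachFin h1).map Fin.valEmbedding = A := by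
    ext j
    simp only [Finset.mem_map, Finset.mem_attachFin, Fin.valEmbedding_apply]
    exact ⟨by rintro ⟨i, hi, rfl⟩; exact hi, fun hj => ⟨⟨j, h1 j hj⟩, hj, rfl⟩⟩
  have h3 : ∑ j ∈ A, β (j + 1) = ∑ j ∈ A.attachFin h1, β (j + 1) := by
    conv_lhs => rw [← h2, Finset.sum_map]
    rfl
  rw [h3] at hA
  have h := korobov_averageError_le_of_le hα hβ hσ hY hε _ hA
  rwa [Finset.card_attachFin] at h

end Complexity

/-! ### Asymptotics of the weights and traces -/

section Parameters

variable {α β σ : ℕ → ℝ} {c τ r : ℝ}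

theorem tendsto_div_add_one_rpow (hc : 0 < c)
    (hβc : Tendsto (fun j : ℕ => β j / (c * (j : ℝ) ^ (-τ))) atTop (𝓝 1)) :
    Tendsto (fun j : ℕ => β (j + 1) / ((j : ℝ) + 1) ^ (-τ)) atTop (𝓝 c) := by
  have h := ((tendsto_add_atTop_iff_nat 1).2 hβc).const_mul c
  rw [mul_one] at h
  refine h.congr fun j => ?_
  push_cast
  have : ((j : ℝ) + 1) ^ (-τ) ≠ 0 := (Real.rpow_pos_of_pos (by positivity) _).ne'
  field_simp

theorem tendsto_korobovTrace_sub_div (hc : 0 < c)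
    (hβc : Tendsto (fun j : ℕ => β j / (c * (j : ℝ) ^ (-τ))) atTop (𝓝 1))
    (hσ_top : Tendsto σ atTop atTop) :
    Tendsto (fun j : ℕ => (korobovTrace (α (j + 1)) (β (j + 1)) (σ (j + 1)) - α (j + 1)) /
      ((j : ℝ) + 1) ^ (-τ)) atTop (𝓝 (2 * c)) := by
  have h1 := (tendsto_div_add_one_rpow hc hβc).const_mul 2
  have h2 := tendsto_tsum_nat_add_one_rpow_neg.comp (hσ_top.comp (tendsto_add_atTop_nat 1))
  have h3 := h1.mul h2
  rw [mul_one] at h3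
  refine h3.congr fun j => ?_
  simp only [Function.comp_apply, korobovTrace]
  ring

theorem tendsto_korobovTrace_div (hc : 0 < c) (hβ : ∀ j, 1 ≤ j → 0 < β j)
    (hβc : Tendsto (fun j : ℕ => β j / (c * (j : ℝ) ^ (-τ))) atTop (𝓝 1))
    (hαβ : Tendsto (fun j : ℕ => α j / β j) atTop (𝓝 r))
    (hσ_top : Tendsto σ atTop atTop) :
    Tendsto (fun j : ℕ => korobovTrace (α (j + 1)) (β (j + 1)) (σ (j + 1)) /
      ((j : ℝ) + 1) ^ (-τ)) atTop (𝓝 ((r + 2) * c)) := by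
  have h1 := ((tendsto_add_atTop_iff_nat 1).2 hαβ).mul (tendsto_div_add_one_rpow hc hβc)
  have h2 := h1.add (tendsto_korobovTrace_sub_div (α := α) hc hβc hσ_top)
  rw [← add_mul] at h2
  refine h2.congr fun j => ?_
  have := (hβ (j + 1) (by omega)).ne'
  rw [div_mul_div_cancel₀ this]
  ring

theorem div_epsZero_sq (hr : 0 ≤ r) (ε : ℝ) : (ε / epsZero r) ^ 2 = ε ^ 2 * (1 + r / 2) := by
  have h : epsZero r ^ 2 = (1 + r / 2)⁻¹ := by
    rw [epsZero, ← Real.rpow_natCast, ← Real.rpow_mul (by positivity)]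
    norm_num [Real.rpow_neg_one]
  rw [div_pow, h, div_inv_eq_mul]

end Parameters

/-! ### Asymptotics of the complexity -/

theorem mainTheorem4 {𝕜 : Type*} [RCLike 𝕜]
    (α β σ : ℕ → ℝ) (c τ r : ℝ)
    (hα : ∀ j, 1 ≤ j → 0 < α j) (hβ : ∀ j, 1 ≤ j → 0 < β j) (hσ : ∀ j, 1 ≤ j → 1 < σ j)
    (hc : 0 < c) (hτ : τ < 1) (hr : 0 ≤ r)
    (hβc : Tendsto (fun j : ℕ => β j / (c * (j : ℝ) ^ (-τ))) atTop (𝓝 1))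
    (hαβ : Tendsto (fun j : ℕ => α j / β j) atTop (𝓝 r))
    (hσ_top : Tendsto σ atTop atTop)
    (Ω : ℕ → Type*) [∀ d, MeasurableSpace (Ω d)]
    (P : ∀ d, Measure (Ω d)) [∀ d, IsProbabilityMeasure (P d)]
    (Y : ∀ d, Cube d → Ω d → 𝕜)
    (hY : ∀ d, 1 ≤ d → IsCenteredField (P d) (Y d) (additiveKorobovCov α β σ d))
    (ε : ℝ) (hε : 0 < ε) (hε₀ : ε < epsZero r) :
    Tendsto (fun d : ℕ => (approxComplexity (P d) (Y d) ε : ℝ) / (2 * korobovQ τ r ε * (d : ℝ)))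
      atTop (𝓝 1) := by
  have hβ' := tendsto_div_add_one_rpow hc hβc
  have hT := tendsto_korobovTrace_div hc hβ hβc hαβ hσ_top
  have hR := tendsto_korobovTrace_sub_div (α := α) hc hβc hσ_top
  have hb : 0 < 1 - τ := sub_pos.2 hτ
  have he0 : 0 < epsZero r := hε.trans hε₀
  have hq0 : 0 < ε / epsZero r := div_pos hε he0
  have hq1 : ε / epsZero r < 1 := (div_lt_one he0).2 hε₀
  have hE := div_epsZero_sq hr ε
  have hE1 : (ε / epsZero r) ^ 2 < 1 := pow_lt_one₀ hq0.le hq1 two_ne_zero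
  have hE0 : 0 < (ε / epsZero r) ^ 2 := by positivity
  have hmem : ∀ {d : ℕ} {A : Finset ℕ}, 1 ≤ d → A ⊆ Finset.range d →
      ∑ j ∈ Finset.range d, (korobovTrace (α (j + 1)) (β (j + 1)) (σ (j + 1)) - α (j + 1)) -
        2 * ∑ j ∈ A, β (j + 1) ≤
        ε ^ 2 * ∑ j ∈ Finset.range d, korobovTrace (α (j + 1)) (β (j + 1)) (σ (j + 1)) →
      2 * A.card + 1 ∈ {n : ℕ | 1 ≤ n ∧
        averageError (P d) (Y d) n ≤ ENNReal.ofReal ε * averageError (P d) (Y d) 0} :=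
    fun hd hAd hA => ⟨by omega,
      korobov_averageError_le_of_subset_range hα hβ hσ (hY _ hd) hε hAd hA⟩
  -- Both signs of `τ` are reduced to the same pair of statements: admissible selections of size
  -- just above `2 Q d`, and the dual inequality forcing at least about `2 Q d` functions. Here `Q`
  -- is the cut `x` for `τ ≥ 0` and `1 - x` for `τ < 0`.
  have key : 0 < korobovQ τ r ε ∧
      (∀ a, 2 * korobovQ τ r ε < a → ∀ᶠ d : ℕ in atTop, ∃ A ⊆ Finset.range d,
        ∑ j ∈ Finset.range d, (korobovTrace (α (j + 1)) (β (j + 1)) (σ (j + 1)) - α (j + 1)) -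
          2 * ∑ j ∈ A, β (j + 1) ≤
          ε ^ 2 * ∑ j ∈ Finset.range d, korobovTrace (α (j + 1)) (β (j + 1)) (σ (j + 1)) ∧
        ((2 * A.card + 1 : ℕ) : ℝ) / d < a) ∧
      ∀ N : ℕ → ℕ, (∀ᶠ d : ℕ in atTop, ∀ θ : ℝ, 0 ≤ θ →
        2 * ∑ j ∈ Finset.range d, min (β (j + 1)) θ - θ * N d ≤
          ε ^ 2 * ∑ j ∈ Finset.range d, korobovTrace (α (j + 1)) (β (j + 1)) (σ (j + 1))) →
        ∀ a, a < 2 * korobovQ τ r ε → ∀ᶠ d : ℕ in atTop, a < (N d : ℝ) / d := by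
    by_cases hτ0 : 0 ≤ τ
    · have hx := Real.rpow_pos_of_pos (sub_pos.2 hE1) (1 / (1 - τ))
      have hx1 := Real.rpow_lt_one (sub_pos.2 hE1).le (by linarith) (one_div_pos.2 hb)
      have hxE : ((1 - (ε / epsZero r) ^ 2) ^ (1 / (1 - τ))) ^ (1 - τ) =
          1 - ε ^ 2 * (1 + r / 2) := by
        rw [← Real.rpow_mul (sub_pos.2 hE1).le, one_div_mul_cancel hb.ne', Real.rpow_one, hE]
      rw [korobovQ, if_pos hτ0]
      exact ⟨hx, fun a ha => exists_finset_of_nonneg hc hτ hβ' hT hR hx hx1 hxE ha,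
        fun N hN a ha => eventually_lt_div_of_dual_of_nonneg hc hτ hβ' hT hτ0 hx hx1 hxE hN ha⟩
    · have hx := Real.rpow_pos_of_pos hq0 (2 / (1 - τ))
      have hx1 := Real.rpow_lt_one hq0.le hq1 (div_pos two_pos hb)
      have hxE : ((ε / epsZero r) ^ (2 / (1 - τ))) ^ (1 - τ) = ε ^ 2 * (1 + r / 2) := by
        rw [← Real.rpow_mul hq0.le, div_mul_cancel₀ _ hb.ne', ← hE]
        exact Real.rpow_two _
      rw [korobovQ, if_neg hτ0]
      exact ⟨sub_pos.2 hx1, fun a ha => exists_finset_of_neg hc hτ hβ' hT hR hx hx1 hxE ha,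
        fun N hN a ha =>
          eventually_lt_div_of_dual_of_neg hc hτ hβ' hT (not_le.1 hτ0) hx hx1 hxE hN ha⟩
  obtain ⟨hQ, hupper, hlower⟩ := key
  have hlim : Tendsto (fun d : ℕ => (approxComplexity (P d) (Y d) ε : ℝ) / d) atTop
      (𝓝 (2 * korobovQ τ r ε)) := by
    refine tendsto_order.2 ⟨hlower _ ?_, fun a ha => ?_⟩
    -- The upper bound is needed here too: `sInf` of the empty set is `0`, so the complexity
    -- satisfies its defining inequality only once some admissible `n` is known to exist.
    · filter_upwards [hupper _ (lt_add_one _), eventually_ge_atTop 1] with d ⟨A, hAd, hA, _⟩ hd θ hθ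
      exact korobov_le_of_averageError_le hα hβ hσ (hY d hd) hε hθ
        (Nat.sInf_mem ⟨_, hmem hd hAd hA⟩).2
    · filter_upwards [hupper a ha, eventually_ge_atTop 1] with d ⟨A, hAd, hA, hlt⟩ hd
      refine lt_of_le_of_lt ?_ hlt
      have : approxComplexity (P d) (Y d) ε ≤ 2 * A.card + 1 := Nat.sInf_le (hmem hd hAd hA)
      gcongr
  have h := hlim.div_const (2 * korobovQ τ r ε)
  rw [div_self (by positivity)] at h
  exact h.congr fun d => by rw [div_div, mul_comm (d : ℝ)]
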